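/- Let $d\ge 2$ be even, let $x\cdot y=x^0y^0-\sum_{i\ge1}x^iy^i$ on $\mathbb R^d$, let $\overline{V_+}=\{q: q\cdot q\ge0,\ q^0\ge0\}$, $\overline{V_-}=-\overline{V_+}$, let $W_0=\{x: x^1>|x^0|\}$ be the right wedge with closure $\overline{W_0}$, edge $E=\{x: x^0=x^1=0\}$ and causal complement $W_0'=-W_0$. Let $\mathscr S_n=\mathscr S(\mathbb R^{nd})$, and let $\underline{\mathscr S}=\bigoplus_{n\ge0}\mathscr S_n$ (with $\mathscr S_0=\mathbb C$) be the Borchers–Uhlmann algebra with the locally convex direct sum topology, the product $(f\otimes g)_n(x_1,\dots,x_n)=\sum_{k=0}^n f_k(x_1,\dots,x_k)\,g_{n-k}(x_{k+1},\dots,x_n)$, the involution $f^*_n(x_1,\dots,x_n)=\overline{f_n(x_n,\dots,x_1)}$ and the unit $1_n=\delta_{n,0}$. Put $\tilde f_n(p_1,\dots,p_n)=(2\pi)^{-nd/2}\int f_n(x_1,\dots,x_n)\,e^{i\sum_k p_k\cdot x_k}\,dx$. For $O\subset\mathbb R^d$ let $\mathscr S_n(O)$ be the set of $f_n\in\mathscr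 S_n$ with $\operatorname{supp} f_n\subset O^{\times n}$, and $\underline{\mathscr S}(O)$ the set of $f\in\underline{\mathscr S}$ for which the smallest closed set $C$ with $\operatorname{supp}f_n\subset C^{\times n}$ for all $n\ge1$ is contained in $O$. Let $R:\mathbb R\to\mathbb C$ be a deformation function: $R$ is smooth, all its derivatives are polynomially bounded, $R(a)^{-1}=\overline{R(a)}=R(-a)$, $R(0)=1$, and the Fourier transform of $R$ as a tempered distribution (with kernel $e^{-ia\lambda}$) is supported in $[0,\infty)$. For $x\in\mathbb R^d$ define $\tau^R_x:\underline{\mathscr S}\to\underline{\mathscr S}$ by $$\widetilde{(\tau^R_xf)_n}(p_1,\dots,p_n)=\tilde f_n(p_1,\dots,p_n)\prod_{k=1}^nR(x\cdot p_k).$$ (i) For every $x\in\mathbb R^d$, $\tau^R_x$ is a continuous automorphism of the unital $^*$-algebra $\underline{\mathscr S}$, with continuous inverse. Let $x\in\overline{W_0}$. If $x=0$ or $x\notin E$, then $\tau^R_{\pm x}(\underline{\mathscr S}(\pm W_0))\subset\underline{\mathscr S}(\pm W_0)$, and for each $n$, $(\tau^R_{\pm x}f)_n\in\mathscr S_n(\pm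 W_0)$ whenever $f_n\in\mathscr S_n(\pm W_0)$. Without this restriction on $x\in\overline{W_0}$, one has $\tau^R_{\pm x}(\underline{\mathscr S}(a\pm\overline{W_0}))\subset\underline{\mathscr S}(a\pm\overline{W_0})$ for every $a\in\mathbb R^d$. (ii) Let $Q$ be an admissible real $d\times d$ matrix: $Q$ is antisymmetric with respect to the Minkowski product, $\Lambda Q\Lambda^{-1}=Q$ (respectively $-Q$) for all proper orthochronous (respectively proper time-reversing) Lorentz transformations $\Lambda$ with $\Lambda W_0=W_0$, and $Q\overline{V_+}\subset\overline{W_0}$. Let $\rho$ be the deformation map $\widetilde{(\rho f)_n}=\rho_n\tilde f_n$ with $\rho_n(p_1,\dots,p_n)=\prod_{1\le l<r\le n}R(-p_l\cdot Qp_r)$, let $\rho'=\alpha_j\circ\rho\circ\alpha_j$, where $(\alpha_jf)_n(x_1,\dots,x_n)=\overline{f_n(jx_1,\dots,jx_n)}$ and $j(x^0,x^1,x^2,\dots)=(-x^0,-x^1,x^2,\dots)$, and let $f\otimes_\rho g=\rho^{-1}(\rho(f)\otimes\rho(g))$, and likewise for $\rho'$. Suppose that $Q\overline{V_+}\cap E\subset\{0\}$,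 and put $(O,O')=(W_0,W_0')$; or, for an arbitrary admissible $Q$, put $(O,O')=(a+\overline{W_0},\,b-\overline{W_0})$ with any $a,b\in\mathbb R^d$. Then for all $n,m\in\mathbb N_0$, $h^\pm\in\mathscr S_m$ with $\operatorname{supp}\tilde h^\pm\subset(\overline{V_\pm})^{\times m}$, $f\in\mathscr S_n(O)$ and $g'\in\mathscr S_n(O')$, $$\operatorname{supp}(h^-\otimes_\rho f)\subset\mathbb R^{md}\times O^{\times n},\qquad \operatorname{supp}(h^-\otimes_{\rho'}g')\subset\mathbb R^{md}\times O'^{\times n},$$ $$\operatorname{supp}(g'\otimes_{\rho'}h^+)\subset O'^{\times n}\times\mathbb R^{md},\qquad \operatorname{supp}(f\otimes_\rho h^+)\subset O^{\times n}\times\mathbb R^{md},$$ where these products are elements of $\mathscr S_{m+n}$. -/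

import Mathlib

open SchwartzMap FourierTransform
open scoped ComplexConjugate Pointwise

noncomputable section

namespace BorchersUhlmann

/-! ### Minkowski space -/

/-- Minkowski space of dimension `d = s + 2`, with coordinates `x 0` (time), `x 1`, …, `x (s + 1)`.
The Euclidean structure serves only for the topology, the volume and the Schwartz spaces. -/
abbrev Spacetime (s : ℕ) : Type := EuclideanSpace ℝ (Fin (s + 2))

/-- The Minkowski inner product, with signature `(+, -, …, -)`. -/
def mdot {s : ℕ} (x y : Spacetime s) : ℝ := x 0 * y 0 - ∑ i : Fin (s + 1), x i.succ * y i.succ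

/-- The right wedge `W₀ = {x : x¹ > |x⁰|}`. -/
def rightWedge (s : ℕ) : Set (Spacetime s) := {x | |x 0| < x 1}

/-- The edge `{x : x⁰ = x¹ = 0}` of the wedge `W₀`. -/
def edge (s : ℕ) : Set (Spacetime s) := {x | x 0 = 0 ∧ x 1 = 0}

/-- The closed forward light cone. -/
def forwardCone (s : ℕ) : Set (Spacetime s) := {q | 0 ≤ mdot q q ∧ 0 ≤ q 0}

/-- A matrix acting on spacetime vectors. -/
def act {s : ℕ} (Q : Matrix (Fin (s + 2)) (Fin (s + 2)) ℝ) (x : Spacetime s) : Spacetime s :=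
  WithLp.toLp 2 (Q.mulVec x.ofLp)

/-- The reflection `j (x⁰, x¹, x², …) = (-x⁰, -x¹, x², …)` at the edge of the wedge. -/
def jFlip (s : ℕ) : Spacetime s ≃ₗᵢ[ℝ] Spacetime s :=
  LinearIsometryEquiv.piLpCongrRight 2 fun i : Fin (s + 2) =>
    if i = 0 ∨ i = 1 then LinearIsometryEquiv.neg ℝ else LinearIsometryEquiv.refl ℝ ℝ

/-- The map `(x⁰, x¹, …) ↦ (x⁰, -x¹, -x², …)`, which converts `mdot` to the Euclidean product. -/
def spaceFlip (s : ℕ) : Spacetime s ≃ₗᵢ[ℝ] Spacetime s :=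
  LinearIsometryEquiv.piLpCongrRight 2 fun i : Fin (s + 2) =>
    if i = 0 then LinearIsometryEquiv.refl ℝ ℝ else LinearIsometryEquiv.neg ℝ

theorem mdot_eq_inner {s : ℕ} (x y : Spacetime s) : mdot x y = inner ℝ y (spaceFlip s x) := by
  simp [mdot, spaceFlip, PiLp.inner_apply, Fin.sum_univ_succ, Fin.succ_ne_zero, sub_eq_add_neg]

/-! ### Schwartz functions of `n` spacetime points -/

/-- Configurations `(x₁, …, xₙ)` of `n` points, i.e. `ℝ^{nd}`. -/
abbrev NPoint (s n : ℕ) : Type := PiLp 2 fun _ : Fin n => Spacetime s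

/-- The Schwartz space `𝒮ₙ = 𝒮(ℝ^{nd})`; for `n = 0` it consists of the constants. -/
abbrev Test (s n : ℕ) : Type := 𝓢(NPoint s n, ℂ)

/-- The linear change of variables `p ↦ -(2π)⁻¹ (spaceFlip p₁, …, spaceFlip pₙ)`. -/
def fourierScale (s n : ℕ) : NPoint s n ≃L[ℝ] NPoint s n :=
  (LinearIsometryEquiv.piLpCongrRight 2
      (fun _ : Fin n => spaceFlip s)).toContinuousLinearEquiv.trans
    (ContinuousLinearEquiv.smulLeft
      (Units.mk0 (-(2 * Real.pi)⁻¹ : ℝ) (neg_ne_zero.2 (inv_ne_zero Real.two_pi_pos.ne'))))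

/-- The normalization `(2π)^{-nd/2}`. -/
def fourierConst (s n : ℕ) : ℂ := (((2 * Real.pi) ^ (-((n * (s + 2) : ℕ) : ℝ) / 2) : ℝ) : ℂ)

theorem fourierConst_ne_zero (s n : ℕ) : fourierConst s n ≠ 0 :=
  Complex.ofReal_ne_zero.2 (Real.rpow_pos_of_pos Real.two_pi_pos _).ne'

/-- The Minkowski Fourier transform `f ↦ f̃` on `𝒮ₙ`, see `momentum_apply` for the integral. -/
def momentum (s n : ℕ) : Test s n ≃L[ℂ] Test s n :=
  ContinuousLinearEquiv.equivOfInverse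
    (fourierConst s n • (compCLMOfContinuousLinearEquiv ℂ (fourierScale s n)).comp
      (fourierCLM ℂ (Test s n)))
    ((fourierConst s n)⁻¹ • (fourierInvCLM ℂ (Test s n)).comp
      (compCLMOfContinuousLinearEquiv ℂ (fourierScale s n).symm))
    (fun f => by
      have h : compCLMOfContinuousLinearEquiv ℂ (fourierScale s n).symm
          (compCLMOfContinuousLinearEquiv ℂ (fourierScale s n) (𝓕 f)) = 𝓕 f := by
        ext x; simp
      simp [h, smul_smul, fourierConst_ne_zero])
    (fun f => by
      have h : compCLMOfContinuousLinearEquiv ℂ (fourierScale s n)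
          (compCLMOfContinuousLinearEquiv ℂ (fourierScale s n).symm f) = f := by
        ext x; simp
      simp [h, smul_smul, fourierConst_ne_zero])

theorem momentum_apply {s n : ℕ} (f : Test s n) (p : NPoint s n) :
    momentum s n f p = (((2 * Real.pi) ^ (-((n * (s + 2) : ℕ) : ℝ) / 2) : ℝ) : ℂ) *
      ∫ x : NPoint s n, Complex.exp (Complex.I * ∑ k, (mdot (p k) (x k) : ℂ)) * f x := by
  have : momentum s n f p = fourierConst s n * 𝓕 (f : NPoint s n → ℂ) (fourierScale s n p) := rfl
  rw [this, Real.fourier_eq', fourierConst]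
  congr 2
  ext x
  rw [smul_eq_mul]
  congr 2
  have h : inner ℝ x (fourierScale s n p) = -(2 * Real.pi)⁻¹ * ∑ k, mdot (p k) (x k) := by
    have h' : fourierScale s n p = (-(2 * Real.pi)⁻¹ : ℝ) •
      (LinearIsometryEquiv.piLpCongrRight 2 (fun _ : Fin n => spaceFlip s) p) := rfl
    rw [h', inner_smul_right, PiLp.inner_apply]
    simp [mdot_eq_inner]
  rw [h]
  have hp : (Real.pi : ℂ) ≠ 0 := by exact_mod_cast Real.pi_ne_zero
  push_cast
  field_simp

/-- The operator on `𝒮ₙ` which multiplies the Fourier transform by the function `M`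
(of temperate growth): `(M̂ f)~ = M · f̃`. -/
def multiplier {s n : ℕ} (M : NPoint s n → ℂ) : Test s n →L[ℂ] Test s n :=
  (momentum s n).symm.toContinuousLinearMap.comp
    ((smulLeftCLM ℂ M).comp (momentum s n).toContinuousLinearMap)

theorem momentum_multiplier {s n : ℕ} {M : NPoint s n → ℂ} (hM : M.HasTemperateGrowth)
    (f : Test s n) (p : NPoint s n) :
    momentum s n (multiplier M f) p = M p * momentum s n f p := by
  simp [multiplier, smulLeftCLM_apply_apply hM]

theorem multiplier_comp {s n : ℕ} {M N : NPoint s n → ℂ} (hM : M.HasTemperateGrowth)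
    (hN : N.HasTemperateGrowth) (h : ∀ p, M p * N p = 1) (f : Test s n) :
    multiplier M (multiplier N f) = f := by
  apply (momentum s n).injective
  ext p
  rw [momentum_multiplier hM, momentum_multiplier hN, ← mul_assoc, h, one_mul]

/-! ### The Borchers–Uhlmann algebra -/

/-- The first `m` of `m + n` points. -/
def firstPoints (s m n : ℕ) : NPoint s (m + n) →L[ℝ] NPoint s m :=
  (PiLp.continuousLinearEquiv 2 ℝ (fun _ : Fin m => Spacetime s)).symm.toContinuousLinearMap.comp
    (ContinuousLinearMap.pi fun k => PiLp.proj 2 (fun _ : Fin (m + n) => Spacetime s)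
      (Fin.castAdd n k))

/-- The last `n` of `m + n` points. -/
def lastPoints (s m n : ℕ) : NPoint s (m + n) →L[ℝ] NPoint s n :=
  (PiLp.continuousLinearEquiv 2 ℝ (fun _ : Fin n => Spacetime s)).symm.toContinuousLinearMap.comp
    (ContinuousLinearMap.pi fun k => PiLp.proj 2 (fun _ : Fin (m + n) => Spacetime s)
      (Fin.natAdd m k))

theorem norm_le_first_add_last {s m n : ℕ} (x : NPoint s (m + n)) :
    ‖x‖ ≤ ‖firstPoints s m n x‖ + ‖lastPoints s m n x‖ := by
  have h : ‖x‖ ^ 2 = ‖firstPoints s m n x‖ ^ 2 + ‖lastPoints s m n x‖ ^ 2 := by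
    rw [PiLp.norm_sq_eq_of_L2, PiLp.norm_sq_eq_of_L2, PiLp.norm_sq_eq_of_L2, Fin.sum_univ_add]
    rfl
  refine le_of_sq_le_sq ?_ (by positivity)
  nlinarith [norm_nonneg (firstPoints s m n x), norm_nonneg (lastPoints s m n x)]

/-- `(f ⊗ g)(x₁, …, x_{m+n}) = f(x₁, …, x_m) g(x_{m+1}, …, x_{m+n})`. -/
def tensor {s m n : ℕ} (f : Test s m) (g : Test s n) : Test s (m + n) where
  toFun x := f (firstPoints s m n x) * g (lastPoints s m n x)
  smooth' := ((f.smooth ⊤).comp (firstPoints s m n).contDiff).mul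
    ((g.smooth ⊤).comp (lastPoints s m n).contDiff)
  decay' k r := by
    obtain ⟨A, hA⟩ : ∃ A : ℕ → ℕ → ℝ, ∀ k i x, ‖x‖ ^ k * ‖iteratedFDeriv ℝ i f x‖ ≤ A k i := by
      choose A hA using f.decay
      exact ⟨A, fun k i => (hA k i).2⟩
    obtain ⟨B, hB⟩ : ∃ B : ℕ → ℕ → ℝ, ∀ k i x, ‖x‖ ^ k * ‖iteratedFDeriv ℝ i g x‖ ≤ B k i := by
      choose B hB using g.decay
      exact ⟨B, fun k i => (hB k i).2⟩
    have hle : ∀ q : ℕ, (q : WithTop ℕ∞) ≤ ((⊤ : ℕ∞) : WithTop ℕ∞) :=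
      fun q => by exact_mod_cast le_top
    set L := firstPoints s m n
    set P := lastPoints s m n
    refine ⟨∑ i ∈ Finset.range (r + 1), (r.choose i : ℝ) * (2 ^ (k - 1) * (‖L‖ ^ i * ‖P‖ ^ (r - i) *
      (A k i * B 0 (r - i) + A 0 i * B k (r - i)))), fun x => ?_⟩
    have h1 := norm_iteratedFDeriv_mul_le (N := (⊤ : ℕ∞)) ((f.smooth ⊤).comp L.contDiff)
      ((g.smooth ⊤).comp P.contDiff) x (n := r) (by exact_mod_cast le_top)
    refine (mul_le_mul_of_nonneg_left h1 (by positivity)).trans ?_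
    rw [Finset.mul_sum]
    refine Finset.sum_le_sum fun i _ => ?_
    have hf : ‖iteratedFDeriv ℝ i (f ∘ L) x‖ ≤ ‖iteratedFDeriv ℝ i f (L x)‖ * ‖L‖ ^ i := by
      rw [L.iteratedFDeriv_comp_right (f.smooth ⊤) x (hle i)]
      simpa using ContinuousMultilinearMap.norm_compContinuousLinearMap_le
        (iteratedFDeriv ℝ i f (L x)) (fun _ => L)
    have hg : ‖iteratedFDeriv ℝ (r - i) (g ∘ P) x‖ ≤
        ‖iteratedFDeriv ℝ (r - i) g (P x)‖ * ‖P‖ ^ (r - i) := by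
      rw [P.iteratedFDeriv_comp_right (g.smooth ⊤) x (hle (r - i))]
      simpa using ContinuousMultilinearMap.norm_compContinuousLinearMap_le
        (iteratedFDeriv ℝ (r - i) g (P x)) (fun _ => P)
    have hx : ‖x‖ ^ k ≤ 2 ^ (k - 1) * (‖L x‖ ^ k + ‖P x‖ ^ k) :=
      (pow_le_pow_left₀ (norm_nonneg _) (norm_le_first_add_last x) k).trans
        (add_pow_le (norm_nonneg _) (norm_nonneg _) k)
    have a0 := hA 0 i (L x)
    have ak := hA k i (L x)
    have b0 := hB 0 (r - i) (P x)
    have bk := hB k (r - i) (P x)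
    rw [pow_zero, one_mul] at a0 b0
    set u := ‖iteratedFDeriv ℝ i f (L x)‖
    set v := ‖iteratedFDeriv ℝ (r - i) g (P x)‖
    have hu : 0 ≤ u := norm_nonneg _
    have hv : 0 ≤ v := norm_nonneg _
    calc ‖x‖ ^ k * ((r.choose i : ℝ) * ‖iteratedFDeriv ℝ i (f ∘ L) x‖ *
          ‖iteratedFDeriv ℝ (r - i) (g ∘ P) x‖)
        ≤ (2 ^ (k - 1) * (‖L x‖ ^ k + ‖P x‖ ^ k)) * ((r.choose i : ℝ) * (u * ‖L‖ ^ i) *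
          (v * ‖P‖ ^ (r - i))) := by gcongr
      _ = (r.choose i : ℝ) * (2 ^ (k - 1) * (‖L‖ ^ i * ‖P‖ ^ (r - i) *
          ((‖L x‖ ^ k * u) * v + u * (‖P x‖ ^ k * v)))) := by ring
      _ ≤ _ := by
        have h3 : (‖L x‖ ^ k * u) * v ≤ A k i * B 0 (r - i) :=
          mul_le_mul ak b0 hv (le_trans (by positivity) ak)
        have h4 : u * (‖P x‖ ^ k * v) ≤ A 0 i * B k (r - i) :=
          mul_le_mul a0 bk (by positivity) (hu.trans a0)
        gcongr

/-- The tensor product of test functions as a bilinear map. -/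
def tensorBilin (s m n : ℕ) : Test s m →ₗ[ℂ] Test s n →ₗ[ℂ] Test s (m + n) :=
  LinearMap.mk₂ ℂ tensor
    (fun f f' g => by ext x; exact add_mul _ _ _)
    (fun c f g => by ext x; exact mul_assoc _ _ _)
    (fun f g g' => by ext x; exact mul_add _ _ _)
    (fun c f g => by ext x; exact mul_left_comm _ _ _)

/-- The Borchers–Uhlmann algebra `⨁ₙ 𝒮ₙ` of terminating sequences of test functions. -/
abbrev BU (s : ℕ) : Type := DirectSum ℕ fun n => Test s n

/-- The inclusion `𝒮ₙ → ⨁ₙ 𝒮ₙ`. -/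
def of (s n : ℕ) : Test s n →ₗ[ℂ] BU s := DirectSum.lof ℂ ℕ (fun n => Test s n) n

/-- The locally convex direct sum topology: the finest locally convex vector space topology which
makes all inclusions `𝒮ₙ → ⨁ₙ 𝒮ₙ` continuous. -/
instance (s : ℕ) : TopologicalSpace (BU s) :=
  sInf {t : TopologicalSpace (BU s) | (∀ n, @Continuous _ _ inferInstance t (of s n)) ∧
    @IsTopologicalAddGroup (BU s) t _ ∧ @ContinuousSMul ℂ (BU s) _ _ t ∧
    @LocallyConvexSpace ℝ (BU s) _ _ _ _ t}

/-- The product `(f ⊗ g)ₙ = ∑ₖ fₖ ⊗ gₙ₋ₖ`, i.e. the bilinear extension of `tensor`. -/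
instance (s : ℕ) : Mul (BU s) where
  mul f g := DirectSum.toModule ℂ ℕ (BU s →ₗ[ℂ] BU s) (fun m =>
    LinearMap.flip (DirectSum.toModule ℂ ℕ (Test s m →ₗ[ℂ] BU s) (fun n =>
      LinearMap.flip ((tensorBilin s m n).compr₂ (of s (m + n)))))) f g

theorem of_mul_of {s m n : ℕ} (f : Test s m) (g : Test s n) :
    of s m f * of s n g = of s (m + n) (tensor f g) := by
  change DirectSum.toModule ℂ ℕ (BU s →ₗ[ℂ] BU s) (fun m =>
    LinearMap.flip (DirectSum.toModule ℂ ℕ (Test s m →ₗ[ℂ] BU s) (fun n =>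
      LinearMap.flip ((tensorBilin s m n).compr₂ (of s (m + n))))))
      (DirectSum.lof ℂ ℕ (fun n => Test s n) m f)
      (DirectSum.lof ℂ ℕ (fun n => Test s n) n g) = _
  rw [DirectSum.toModule_lof, LinearMap.flip_apply, DirectSum.toModule_lof]
  rfl

/-- The constant function `1` on zero points. -/
def oneTest (s : ℕ) : Test s 0 :=
  HasCompactSupport.toSchwartzMap (f := fun _ => (1 : ℂ)) (HasCompactSupport.of_compactSpace _)
    contDiff_const

/-- The unit `1ₙ = δ_{n,0}`. -/
instance (s : ℕ) : One (BU s) where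
  one := of s 0 (oneTest s)

/-- Complex conjugation of test functions. -/
def conjTest (s n : ℕ) : Test s n →L[ℝ] Test s n :=
  postcompCLM (𝕜 := ℝ) (Complex.conjCLE : ℂ →L[ℝ] ℂ)

/-- `fₙ* (x₁, …, xₙ) = conj (fₙ (xₙ, …, x₁))`. -/
def starTest (s n : ℕ) : Test s n →L[ℝ] Test s n :=
  (conjTest s n).comp (compCLMOfContinuousLinearEquiv ℝ
    (LinearIsometryEquiv.piLpCongrLeft 2 ℝ (Spacetime s)
      (Fin.revPerm (n := n))).toContinuousLinearEquiv)

theorem starTest_apply {s n : ℕ} (f : Test s n) (x : NPoint s n) :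
    starTest s n f x = conj (f (WithLp.toLp 2 fun k => x k.rev)) := rfl

/-- The involution `f ↦ f*`. -/
instance (s : ℕ) : Star (BU s) where
  star := DFinsupp.mapRange (fun n => starTest s n) (fun n => map_zero (starTest s n))

/-- `(α_j fₙ)(x₁, …, xₙ) = conj (fₙ (j x₁, …, j xₙ))`. -/
def jTest (s n : ℕ) : Test s n →L[ℝ] Test s n :=
  (conjTest s n).comp (compCLMOfContinuousLinearEquiv ℝ
    (LinearIsometryEquiv.piLpCongrRight 2
      (fun _ : Fin n => jFlip s)).toContinuousLinearEquiv)

theorem jTest_apply {s n : ℕ} (f : Test s n) (x : NPoint s n) :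
    jTest s n f x = conj (f (WithLp.toLp 2 fun k => jFlip s (x k))) := rfl

theorem jTest_jTest {s n : ℕ} (f : Test s n) : jTest s n (jTest s n f) = f := by
  ext x
  have h : ∀ y : Spacetime s, jFlip s (jFlip s y) = y := by
    intro y
    ext i
    by_cases hi : i = 0 ∨ i = 1 <;> simp [jFlip, hi]
  simp [jTest_apply, h]

/-- The antilinear reflection `α_j` on the Borchers–Uhlmann algebra, an involution. -/
def alphaJ (s : ℕ) : BU s ≃ BU s :=
  Function.Involutive.toPerm
    (DFinsupp.mapRange (fun n => jTest s n) (fun n => map_zero (jTest s n)))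
    (fun f => by
      refine DFinsupp.ext fun n => ?_
      rw [DFinsupp.mapRange_apply, DFinsupp.mapRange_apply, jTest_jTest])

/-! ### Supports -/

/-- The support of `f`: the smallest closed set `O` with `supp fₙ ⊆ O × ⋯ × O` for all `n ≥ 1`. -/
def supp {s : ℕ} (f : BU s) : Set (Spacetime s) :=
  ⋂₀ {O | IsClosed O ∧ ∀ n, 1 ≤ n → tsupport (f n) ⊆ {x | ∀ k, x k ∈ O}}

/-- `𝒮(O)`, the elements of the Borchers–Uhlmann algebra with support in `O`. -/
def localAlgebra {s : ℕ} (O : Set (Spacetime s)) : Set (BU s) := {f | supp f ⊆ O}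

/-- `𝒮ₙ(O)`, the functions in `𝒮ₙ` with support in `O × ⋯ × O`. -/
def localTest {s : ℕ} (n : ℕ) (O : Set (Spacetime s)) : Set (Test s n) :=
  {f | tsupport f ⊆ {x | ∀ k, x k ∈ O}}

/-- The functions in `𝒮ₙ` whose Fourier transform has support in `O × ⋯ × O`. -/
def momentumLocalTest {s : ℕ} (n : ℕ) (O : Set (Spacetime s)) : Set (Test s n) :=
  {f | tsupport (momentum s n f) ⊆ {p | ∀ k, p k ∈ O}}

/-- `u ∈ 𝒮_{m+n}` with support in `ℝ^{md} × O × ⋯ × O` (`n` factors `O`). -/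
def LastSupported {s : ℕ} (m n : ℕ) (O : Set (Spacetime s)) (u : BU s) : Prop :=
  ∃ F : Test s (m + n), u = of s (m + n) F ∧
    tsupport F ⊆ {x | ∀ k : Fin n, x (Fin.natAdd m k) ∈ O}

/-- `u ∈ 𝒮_{n+m}` with support in `O × ⋯ × O × ℝ^{md}` (`n` factors `O`). -/
def FirstSupported {s : ℕ} (n m : ℕ) (O : Set (Spacetime s)) (u : BU s) : Prop :=
  ∃ F : Test s (n + m), u = of s (n + m) F ∧
    tsupport F ⊆ {x | ∀ k : Fin n, x (Fin.castAdd m k) ∈ O}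

/-! ### Deformation functions, shifts and deformed products -/

/-- A deformation function: a smooth function `R : ℝ → ℂ`, all of whose derivatives are
polynomially bounded, with `R(a)⁻¹ = conj (R(a)) = R(-a)` and `R(0) = 1`, such that the Fourier
transform of `R` as a tempered distribution has support in the half line `[0, ∞)`. The Fourier
transform of distributions on `ℝ` has the kernel `exp(-2πi a λ)`. -/
structure DeformationFunction where
  toFun : ℝ → ℂ
  temperate : toFun.HasTemperateGrowth
  mul_conj : ∀ a, toFun a * conj (toFun a) = 1
  conj_eq : ∀ a, conj (toFun a) = toFun (-a)
  map_zero : toFun 0 = 1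
  support : Distribution.dsupport
    ⇑(𝓕 (temperate.toTemperedDistribution MeasureTheory.volume) : 𝓢'(ℝ, ℂ)) ⊆ Set.Ici 0

instance : CoeFun DeformationFunction fun _ => ℝ → ℂ where
  coe := DeformationFunction.toFun

/-- The map `τ^R_x`: `(τ^R_x f)ₙ~ (p₁, …, pₙ) = f̃ₙ(p₁, …, pₙ) ∏ₖ R(x · pₖ)`. -/
def shift {s : ℕ} (R : DeformationFunction) (x : Spacetime s) : BU s →ₗ[ℂ] BU s :=
  DFinsupp.mapRange.linearMap fun n =>
    (multiplier fun p : NPoint s n => ∏ k, R (mdot x (p k))).toLinearMap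

/-- The deformation two-point function `ρ₂(p, q) = R(-p · Qq)`. -/
def rho2 {s : ℕ} (R : DeformationFunction) (Q : Matrix (Fin (s + 2)) (Fin (s + 2)) ℝ)
    (p q : Spacetime s) : ℂ := R (-mdot p (act Q q))

/-- The deformation `n`-point function `ρₙ(p₁, …, pₙ) = ∏_{l < r} ρ₂(p_l, p_r)`. -/
def rhoN {s : ℕ} (R : DeformationFunction) (Q : Matrix (Fin (s + 2)) (Fin (s + 2)) ℝ) (n : ℕ)
    (p : NPoint s n) : ℂ := ∏ l : Fin n, ∏ r ∈ Finset.Ioi l, rho2 R Q (p l) (p r)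

theorem hasTemperateGrowth_prod {ι E : Type*} [NormedAddCommGroup E] [NormedSpace ℝ E]
    (t : Finset ι) (M : ι → E → ℂ) (h : ∀ i ∈ t, (M i).HasTemperateGrowth) :
    (fun p => ∏ i ∈ t, M i p).HasTemperateGrowth := by
  classical
  induction t using Finset.induction_on with
  | empty => simp
  | insert a t ha ih =>
    simp only [Finset.prod_insert ha]
    exact (h a (Finset.mem_insert_self a t)).mul
      (ih fun i hi => h i (Finset.mem_insert_of_mem hi))

theorem hasTemperateGrowth_coord (s n : ℕ) (k : Fin n) (i : Fin (s + 2)) :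
    (fun p : NPoint s n => p k i).HasTemperateGrowth :=
  ((PiLp.proj 2 (fun _ : Fin (s + 2) => ℝ) i : Spacetime s →L[ℝ] ℝ).comp
    (PiLp.proj 2 (fun _ : Fin n => Spacetime s) k : NPoint s n →L[ℝ] Spacetime s)).hasTemperateGrowth

theorem shift_temperate {s n : ℕ} (R : DeformationFunction) (x : Spacetime s) :
    (fun p : NPoint s n => ∏ k, R (mdot x (p k))).HasTemperateGrowth := by
  refine hasTemperateGrowth_prod _ _ fun k _ => R.temperate.comp ?_
  have h := hasTemperateGrowth_coord s n k
  refine ((Function.HasTemperateGrowth.const _).mul (h 0)).sub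
    (.sum fun i _ => (Function.HasTemperateGrowth.const _).mul (h i.succ))

theorem momentum_shift {s n : ℕ} (R : DeformationFunction) (x : Spacetime s) (f : BU s)
    (p : NPoint s n) : momentum s n (shift R x f n) p =
      momentum s n (f n) p * ∏ k, R (mdot x (p k)) :=
  (momentum_multiplier (shift_temperate R x) (f n) p).trans (mul_comm _ _)

theorem rhoN_temperate {s : ℕ} (R : DeformationFunction)
    (Q : Matrix (Fin (s + 2)) (Fin (s + 2)) ℝ) (n : ℕ) : (rhoN R Q n).HasTemperateGrowth := by
  refine hasTemperateGrowth_prod _ _ fun l _ => hasTemperateGrowth_prod _ _ fun r _ =>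
    R.temperate.comp (.neg ?_)
  have hl := hasTemperateGrowth_coord s n l
  have hr := hasTemperateGrowth_coord s n r
  have hQ : ∀ i, (fun p : NPoint s n => act Q (p r) i).HasTemperateGrowth := fun i =>
    (Function.HasTemperateGrowth.sum (s := Finset.univ) (f := fun j (p : NPoint s n) =>
      Q i j * p r j) fun j _ => (Function.HasTemperateGrowth.const (Q i j)).mul (hr j) :)
  exact ((hl 0).mul (hQ 0)).sub (.sum fun i _ => (hl i.succ).mul (hQ i.succ))

theorem rhoN_mul_rhoN_neg {s : ℕ} (R : DeformationFunction)
    (Q : Matrix (Fin (s + 2)) (Fin (s + 2)) ℝ) (n : ℕ) (p : NPoint s n) :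
    rhoN R Q n p * rhoN R (-Q) n p = 1 := by
  simp only [rhoN, ← Finset.prod_mul_distrib]
  refine Finset.prod_eq_one fun l _ => Finset.prod_eq_one fun r _ => ?_
  have h : -mdot (p l) (act (-Q) (p r)) = -(-mdot (p l) (act Q (p r))) := by
    simp [mdot, act, Matrix.neg_mulVec]
    ring
  rw [rho2, rho2, h, ← R.conj_eq (-mdot (p l) (act Q (p r))), R.mul_conj]

/-- The multiplicative deformation map `ρ = ρ(R, Q)`: `(ρ f)ₙ~ = ρₙ · f̃ₙ`. -/
def rho {s : ℕ} (R : DeformationFunction) (Q : Matrix (Fin (s + 2)) (Fin (s + 2)) ℝ) :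
    BU s ≃ₗ[ℂ] BU s :=
  DFinsupp.mapRange.linearEquiv fun n =>
    LinearEquiv.ofLinearMap (multiplier (rhoN R Q n)).toLinearMap
      (multiplier (rhoN R (-Q) n)).toLinearMap
      (LinearMap.ext fun f => multiplier_comp (rhoN_temperate R Q n) (rhoN_temperate R (-Q) n)
        (rhoN_mul_rhoN_neg R Q n) f)
      (LinearMap.ext fun f => multiplier_comp (rhoN_temperate R (-Q) n) (rhoN_temperate R Q n)
        (fun p => (mul_comm _ _).trans (rhoN_mul_rhoN_neg R Q n p)) f)

theorem momentum_rho {s n : ℕ} (R : DeformationFunction)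
    (Q : Matrix (Fin (s + 2)) (Fin (s + 2)) ℝ) (f : BU s) (p : NPoint s n) :
    momentum s n (rho R Q f n) p = rhoN R Q n p * momentum s n (f n) p :=
  momentum_multiplier (rhoN_temperate R Q n) (f n) p

/-- The opposite deformation map `ρ' = α_j ∘ ρ ∘ α_j`. -/
def opposite {s : ℕ} (ρ : BU s ≃ BU s) : BU s ≃ BU s :=
  (alphaJ s).trans (ρ.trans (alphaJ s))

/-- The deformed product `f ⊗_ρ g = ρ⁻¹(ρ(f) ⊗ ρ(g))`. -/
def deformedMul {s : ℕ} (ρ : BU s ≃ BU s) (f g : BU s) : BU s := ρ.symm (ρ f * ρ g)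

/-- Lorentz transformations. -/
def IsLorentz {s : ℕ} (Λ : Matrix (Fin (s + 2)) (Fin (s + 2)) ℝ) : Prop :=
  ∀ x y : Spacetime s, mdot (act Λ x) (act Λ y) = mdot x y

/-- Admissible matrices: antisymmetric for the Minkowski product, with `Λ Q Λ⁻¹ = Q` or
`Λ Q Λ⁻¹ = -Q` for the proper Lorentz transformations `Λ` with `Λ W₀ = W₀` which are orthochronous
or time reversing, respectively, and mapping the closed forward light cone into the closure
of `W₀`. -/
structure IsAdmissible {s : ℕ} (Q : Matrix (Fin (s + 2)) (Fin (s + 2)) ℝ) : Prop where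
  antisymm : ∀ p q : Spacetime s, mdot p (act Q q) = -mdot (act Q p) q
  orthochronous : ∀ Λ : Matrix (Fin (s + 2)) (Fin (s + 2)) ℝ, IsLorentz Λ → Λ.det = 1 →
    0 < Λ 0 0 → act Λ '' rightWedge s = rightWedge s → Λ * Q * Λ⁻¹ = Q
  timeReversing : ∀ Λ : Matrix (Fin (s + 2)) (Fin (s + 2)) ℝ, IsLorentz Λ → Λ.det = 1 →
    Λ 0 0 < 0 → act Λ '' rightWedge s = rightWedge s → Λ * Q * Λ⁻¹ = -Q
  map_cone : ∀ p ∈ forwardCone s, act Q p ∈ closure (rightWedge s)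

/-- The support statement for products deformed with `ρ = ρ(R, Q)` and `ρ'`: for all `h⁻`, `h⁺`
with momentum support in the backward and forward cone, `f ∈ 𝒮ₙ(O)` and `g' ∈ 𝒮ₙ(O')`,
`supp (h⁻ ⊗_ρ f) ⊆ ℝ^{md} × Oⁿ`, `supp (h⁻ ⊗_ρ' g') ⊆ ℝ^{md} × O'ⁿ`,
`supp (g' ⊗_ρ' h⁺) ⊆ O'ⁿ × ℝ^{md}` and `supp (f ⊗_ρ h⁺) ⊆ Oⁿ × ℝ^{md}`. -/
def ProductsKeepSupport {s : ℕ} (R : DeformationFunction)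
    (Q : Matrix (Fin (s + 2)) (Fin (s + 2)) ℝ) (O O' : Set (Spacetime s)) : Prop :=
  ∀ (n m : ℕ) (hm hp : Test s m) (f g' : Test s n),
    hm ∈ momentumLocalTest m (-forwardCone s) → hp ∈ momentumLocalTest m (forwardCone s) →
    f ∈ localTest n O → g' ∈ localTest n O' →
    LastSupported m n O (deformedMul (rho R Q).toEquiv (of s m hm) (of s n f)) ∧
    LastSupported m n O' (deformedMul (opposite (rho R Q).toEquiv) (of s m hm) (of s n g')) ∧
    FirstSupported n m O' (deformedMul (opposite (rho R Q).toEquiv) (of s n g') (of s m hp)) ∧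
    FirstSupported n m O (deformedMul (rho R Q).toEquiv (of s n f) (of s m hp))

end BorchersUhlmann

end

/-!
The core of the proof is that a deformation function `R` is a superposition of the characters
`a ↦ exp(i a c)` with `c ≥ 0`, because its Fourier transform is supported in `[0, ∞)`. Multiplying a
Fourier transform by `R(x · p_k)` therefore superposes translations of the `k`-th point by `c x`,
`c ≥ 0`: the new function can be nonzero only at points `y` for which the old one is nonzero at some
`y - c x` (`fourierMultiplier_deformation_eq_zero`). The Fourier transform of `R` being a
distribution, this is proved by regularizing `R` to Schwartz functions whose Fourier transforms
vanish on `(-∞, 0)`.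

Iterating over several factors, a multiplier `∏ᵢ R(xᵢ · p_{kᵢ})` with all `xᵢ` in a convex cone `K`
enlarges the set where a function is nonzero by at most `K × ⋯ × K`
(`multiplier_prod_support_cone`). Supports are closures of these sets, so for an open region `O` it
must be checked that closed subsets of `O × ⋯ × O` plus `K × ⋯ × K` stay within closed subsets of
`O × ⋯ × O` (`KeepsLocal`). For `O = W₀` this holds if `‖z‖ ≤ C z¹` on `K` (`narrowCone`), which is
where the condition on the edge enters; for translates of the closed wedge nothing is needed.

For the shift `τ^R_x` the only vector involved is `x`. The remaining algebraic statements about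
`τ^R_x` follow from the behaviour of the Fourier transform under tensor products and conjugation,
and continuity from the universal property of the direct sum topology (`continuous_of_graded`).

In a deformed product the factors of `ρ_{m+n}` within each of the two functions cancel and there
remain the factors `R(p_l · Q p_r)` joining them (`fourier_deformedTensor`). With the momenta of
`h^±` fixed in the light cone, these factors act on the other function as shifts by vectors of
`Q V̄₊` (by antisymmetry of `Q` if `h` stands on the left), and integrating over the fixed momenta
does not enlarge the support. If `Q V̄₊` meets the edge at most in `0` then it lies in a narrow cone
(`IsAdmissible.exists_narrowCone`). The products deformed with `ρ'` are conjugate under `α_j` to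
those deformed with `ρ` (`deformedMul_opposite_of_of`), where `j` exchanges `W₀` and `W₀'`.
-/

noncomputable section

namespace BorchersUhlmann

open MeasureTheory Filter Topology

/-! ### Deformation functions as superpositions of translations -/

/-- A tempered distribution vanishes on test functions with compact support disjoint from its own
support. The definition of the support only gives this locally; a smooth partition of unity
globalizes it. -/
theorem eq_zero_of_disjoint_dsupport {E F : Type*} [NormedAddCommGroup E] [NormedSpace ℝ E]
    [FiniteDimensional ℝ E] [NormedAddCommGroup F] [NormedSpace ℂ F] (T : 𝓢'(E, F)) (u : 𝓢(E, ℂ))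
    (hu : HasCompactSupport u) (hd : Disjoint (tsupport u) (Distribution.dsupport T)) :
    T u = 0 := by
  have hloc : ∀ x : E, ∃ U : Set E, IsOpen U ∧ (x ∈ tsupport u → x ∈ U) ∧
      Distribution.IsVanishingOn T U := by
    intro x
    by_cases hx : x ∈ tsupport u
    · obtain ⟨U, h1, h2, h3⟩ := (Distribution.notMem_dsupport_iff (f := T) x).1
        (Set.disjoint_left.1 hd hx)
      exact ⟨U, h2, fun _ => h3, h1⟩
    · refine ⟨∅, isOpen_empty, fun h => absurd h hx, fun v hv => ?_⟩
      have : v = 0 := by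
        ext y
        by_contra hy
        exact hv (subset_tsupport _ hy)
      rw [this, map_zero]
  choose U hUo hxU hUv using hloc
  obtain ⟨φ, hφ⟩ := SmoothPartitionOfUnity.exists_isSubordinate (modelWithCornersSelf ℝ E)
    (isClosed_tsupport u) U hUo (fun x hx => Set.mem_iUnion.2 ⟨x, hxU x hx⟩)
  have hfin := φ.locallyFinite.finite_nonempty_inter_compact hu
  have hs : ∀ i, ContDiff ℝ (⊤ : ℕ∞) (fun x => ((φ i x : ℝ) : ℂ) * u x) := fun i =>
    (Complex.ofRealCLM.contDiff.comp (φ i).contMDiff.contDiff).mul (u.smooth ⊤)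
  let v : E → 𝓢(E, ℂ) := fun i =>
    (hu.mul_left (f := fun x => ((φ i x : ℝ) : ℂ))).toSchwartzMap (hs i)
  have hv : ∀ i x, v i x = ((φ i x : ℝ) : ℂ) * u x := fun i x => rfl
  have hsum : u = ∑ i ∈ hfin.toFinset, v i := by
    ext x
    rw [sum_apply]
    simp only [hv]
    rw [← Finset.sum_mul]
    by_cases hx : u x = 0
    · simp [hx]
    have hx' : x ∈ tsupport u := subset_tsupport _ hx
    have h1 := φ.sum_eq_one hx'
    rw [finsum_eq_sum_of_support_subset (s := hfin.toFinset)] at h1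
    · have : (∑ i ∈ hfin.toFinset, ((φ i x : ℝ) : ℂ)) = 1 := by exact_mod_cast h1
      rw [this, one_mul]
    · intro i hi
      simp only [Set.Finite.coe_toFinset]
      exact ⟨x, hi, hx'⟩
  rw [hsum, map_sum]
  refine Finset.sum_eq_zero fun i _ => hUv i _ ?_
  refine subset_trans (closure_mono fun x hx => ?_) (hφ i)
  intro h
  apply hx
  change ((φ i x : ℝ) : ℂ) * u x = 0
  rw [h]; simp

theorem norm_deformationFunction (R : DeformationFunction) (a : ℝ) : ‖R a‖ = 1 := by
  have h := R.mul_conj a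
  rw [Complex.mul_conj] at h
  have h2 : Complex.normSq (R a) = 1 := by exact_mod_cast h
  rw [Complex.normSq_eq_norm_sq] at h2
  exact (pow_eq_one_iff_of_nonneg (norm_nonneg _) two_ne_zero).1 h2

/-- The Fourier transform of the function `t ↦ r⁻¹ χ((μ - t) / r)`. -/
theorem fourier_reflected_scaled (χ : ℝ → ℂ) (r : ℝ) (hr : 0 < r) (μ a : ℝ) :
    𝓕 (fun t : ℝ => (r⁻¹ : ℂ) * χ (r⁻¹ * (μ - t))) a =
      Complex.exp (((-2 * Real.pi * (a * μ) : ℝ) : ℂ) * Complex.I) * 𝓕⁻ χ (r * a) := by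
  rw [Real.fourier_eq', Real.fourierInv_eq', ← integral_const_mul]
  set F : ℝ → ℂ := fun v => Complex.exp (((-2 * Real.pi * (a * μ) : ℝ) : ℂ) * Complex.I) *
    (Complex.exp (((2 * Real.pi * inner ℝ v (r * a) : ℝ) : ℂ) * Complex.I) • χ v) with hF
  have h1 : ∀ t : ℝ, Complex.exp (((-2 * Real.pi * inner ℝ t a : ℝ) : ℂ) * Complex.I) •
      ((r⁻¹ : ℂ) * χ (r⁻¹ * (μ - t))) = (r⁻¹ : ℂ) * F (r⁻¹ * (μ - t)) := by
    intro t
    simp only [hF, smul_eq_mul]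
    rw [← mul_assoc (Complex.exp _) (Complex.exp _), ← Complex.exp_add]
    have : ((-2 * Real.pi * inner ℝ t a : ℝ) : ℂ) * Complex.I =
      ((-2 * Real.pi * (a * μ) : ℝ) : ℂ) * Complex.I +
      ((2 * Real.pi * inner ℝ (r⁻¹ * (μ - t)) (r * a) : ℝ) : ℂ) * Complex.I := by
      rw [← add_mul, ← Complex.ofReal_add]
      congr 2
      simp
      field_simp
      ring
    rw [this]
    ring
  simp_rw [h1]
  rw [integral_const_mul, integral_sub_left_eq_self (fun t => F (r⁻¹ * t)) volume μ,
    Measure.integral_comp_mul_left F r⁻¹]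
  rw [inv_inv, abs_of_pos hr, Complex.real_smul, ← mul_assoc, inv_mul_cancel₀, one_mul]
  exact_mod_cast hr.ne'

/-- The Fourier transform of the regularization `R(a) (𝓕⁻¹ χ)(r a)` at `μ` is the distribution `𝓕 R`
applied to `t ↦ r⁻¹ χ((μ - t) / r)`. For `μ < 0` this test function is supported in `(-∞, μ]`, away
from the support of `𝓕 R`. -/
theorem fourier_cutoff_eq_zero (R : DeformationFunction) (χ : 𝓢(ℝ, ℂ)) (hχ : HasCompactSupport χ)
    (hχ0 : tsupport χ ⊆ Set.Ici 0) (r : ℝ) (hr : 0 < r) (G : 𝓢(ℝ, ℂ))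
    (hG : ∀ a, G a = R a * 𝓕⁻ (χ : ℝ → ℂ) (r * a)) (μ : ℝ) (hμ : μ < 0) : 𝓕 G μ = 0 := by
  have hcont : Continuous fun t : ℝ => r⁻¹ * (μ - t) := by fun_prop
  have hemb : Topology.IsClosedEmbedding fun t : ℝ => r⁻¹ * (μ - t) :=
    ((Homeomorph.subLeft μ).trans (Homeomorph.mulLeft₀ r⁻¹ (inv_ne_zero hr.ne'))).isClosedEmbedding
  have hc : HasCompactSupport (fun t : ℝ => (r⁻¹ : ℂ) * χ (r⁻¹ * (μ - t))) :=
    (hχ.comp_isClosedEmbedding hemb).mul_left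
  have hsm : ContDiff ℝ (⊤ : ℕ∞) (fun t : ℝ => (r⁻¹ : ℂ) * χ (r⁻¹ * (μ - t))) :=
    contDiff_const.mul ((χ.smooth ⊤).comp (by fun_prop))
  set u : 𝓢(ℝ, ℂ) := hc.toSchwartzMap hsm with hu
  have hcoe : (u : ℝ → ℂ) = fun t : ℝ => (r⁻¹ : ℂ) * χ (r⁻¹ * (μ - t)) := rfl
  have hz := eq_zero_of_disjoint_dsupport
    (𝓕 (R.temperate.toTemperedDistribution MeasureTheory.volume) : 𝓢'(ℝ, ℂ)) u hc (by
    refine Set.disjoint_left.2 fun t ht htd => ?_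
    have h1 : (0 : ℝ) ≤ t := R.support htd
    have h2 : t ∈ (fun t : ℝ => r⁻¹ * (μ - t)) ⁻¹' tsupport χ := by
      refine closure_minimal (fun t ht => ?_) ((isClosed_tsupport χ).preimage hcont) ht
      exact subset_tsupport _ (right_ne_zero_of_mul ht)
    have h3 : 0 ≤ r⁻¹ * (μ - t) := hχ0 h2
    have h4 : r⁻¹ * (μ - t) < 0 := mul_neg_of_pos_of_neg (inv_pos.2 hr) (by linarith)
    linarith)
  replace hz : ∫ a, (𝓕 u) a • R a = 0 := hz
  rw [SchwartzMap.fourier_coe, Real.fourier_eq', ← hz]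
  congr 1
  ext a
  rw [SchwartzMap.fourier_coe, hcoe, fourier_reflected_scaled _ _ hr, hG, smul_eq_mul, smul_eq_mul]
  rw [show inner ℝ a μ = a * μ by simp [mul_comm]]
  ring

theorem exists_cutoff : ∃ χ : 𝓢(ℝ, ℂ), HasCompactSupport χ ∧ tsupport χ ⊆ Set.Ici 0 ∧
    ∫ x, χ x = 1 := by
  -- The radius `1 / 2` keeps the support in `[1/2, 3/2]`, inside the half line.
  let φ : ContDiffBump (1 : ℝ) := ⟨1 / 4, 1 / 2, by norm_num, by norm_num⟩
  have hc : HasCompactSupport (Complex.ofRealCLM ∘ φ.normed volume) :=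
    φ.hasCompactSupport_normed.comp_left rfl
  refine ⟨hc.toSchwartzMap (Complex.ofRealCLM.contDiff.comp φ.contDiff_normed), hc, ?_, ?_⟩
  · refine (tsupport_comp_subset (g := Complex.ofRealCLM) rfl (φ.normed volume)).trans ?_
    rw [φ.tsupport_normed_eq]
    intro x hx
    rw [Metric.mem_closedBall, Real.dist_eq, abs_le] at hx
    change -(1 / 2 : ℝ) ≤ _ ∧ _ ≤ (1 / 2 : ℝ) at hx
    exact Set.mem_Ici.2 (by linarith [hx.1])
  · change ∫ x, ((φ.normed volume x : ℝ) : ℂ) = 1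
    rw [integral_complex_ofReal, φ.integral_normed, Complex.ofReal_one]

theorem eq_integral_fourier {V : Type*} [NormedAddCommGroup V] [InnerProductSpace ℝ V]
    [FiniteDimensional ℝ V] [MeasurableSpace V] [BorelSpace V] (f : 𝓢(V, ℂ)) (x : V) :
    f x = ∫ w, Complex.exp (((2 * Real.pi * inner ℝ w x : ℝ) : ℂ) * Complex.I) * 𝓕 f w := by
  conv_lhs => rw [← FourierTransform.fourierInv_fourier_eq (F := 𝓢(V, ℂ)) f]
  rw [SchwartzMap.fourierInv_coe, Real.fourierInv_eq']
  simp

/-- Multiplying `f̂` by `G(-2π ⟨w, v⟩)` superposes the translates of `f` in the direction `v` with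
the weight `Ĝ`. -/
theorem integral_schwartz_comp_inner {V : Type*} [NormedAddCommGroup V] [InnerProductSpace ℝ V]
    [FiniteDimensional ℝ V] [MeasurableSpace V] [BorelSpace V] (G : 𝓢(ℝ, ℂ)) (f : 𝓢(V, ℂ))
    (v y : V) :
    ∫ w : V, Complex.exp (((2 * Real.pi * inner ℝ w y : ℝ) : ℂ) * Complex.I) *
      (G (-2 * Real.pi * inner ℝ w v) * 𝓕 f w) =
    ∫ μ : ℝ, 𝓕 G μ * f (y - (2 * Real.pi * μ) • v) := by
  have hG : ∀ a, G a =
      ∫ μ : ℝ, Complex.exp (((2 * Real.pi * (μ * a) : ℝ) : ℂ) * Complex.I) * 𝓕 G μ := by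
    intro a
    rw [eq_integral_fourier G a]
    simp [mul_comm]
  have key : ∀ (w : V) (μ : ℝ), Complex.exp (((2 * Real.pi * inner ℝ w y : ℝ) : ℂ) * Complex.I) *
      ((Complex.exp (((2 * Real.pi * (μ * (-2 * Real.pi * inner ℝ w v)) : ℝ) : ℂ) * Complex.I)
        * 𝓕 G μ) * 𝓕 f w) = 𝓕 G μ *
        (Complex.exp (((2 * Real.pi * inner ℝ w (y - (2 * Real.pi * μ) • v) : ℝ) : ℂ) * Complex.I)
          * 𝓕 f w) := by
    intro w μ
    have : Complex.exp (((2 * Real.pi * inner ℝ w (y - (2 * Real.pi * μ) • v) : ℝ) : ℂ) * Complex.I)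
      = Complex.exp (((2 * Real.pi * inner ℝ w y : ℝ) : ℂ) * Complex.I) *
        Complex.exp (((2 * Real.pi * (μ * (-2 * Real.pi * inner ℝ w v)) : ℝ) : ℂ) * Complex.I) := by
      rw [← Complex.exp_add, ← add_mul, ← Complex.ofReal_add]
      congr 3
      rw [inner_sub_right, inner_smul_right]
      ring
    rw [this]; ring
  calc _ = ∫ w : V, ∫ μ : ℝ, 𝓕 G μ *
        (Complex.exp (((2 * Real.pi * inner ℝ w (y - (2 * Real.pi * μ) • v) : ℝ) : ℂ) * Complex.I)
          * 𝓕 f w) := by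
        refine integral_congr_ae (ae_of_all _ fun w => ?_)
        dsimp only
        rw [hG, ← integral_mul_const, ← integral_const_mul]
        simp_rw [key]
    _ = ∫ μ : ℝ, ∫ w : V, 𝓕 G μ *
        (Complex.exp (((2 * Real.pi * inner ℝ w (y - (2 * Real.pi * μ) • v) : ℝ) : ℂ) * Complex.I)
          * 𝓕 f w) := by
        refine integral_integral_swap ?_
        have h := (𝓕 f).integrable (μ := volume) |>.mul_prod ((𝓕 G).integrable (μ := volume))
        refine h.mono (Continuous.aestronglyMeasurable ?_) (ae_of_all _ fun z => ?_)
        · have h1 := (𝓕 f).continuous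
          have h2 := (𝓕 G).continuous
          simp only [Function.uncurry_def]
          fun_prop
        · simp only [Function.uncurry, norm_mul, Complex.norm_exp_ofReal_mul_I, one_mul]
          rw [mul_comm]
    _ = _ := by
        refine integral_congr_ae (ae_of_all _ fun μ => ?_)
        dsimp only
        rw [integral_const_mul, ← eq_integral_fourier]

/-- The multiplier `R(-2π ⟨w, v⟩)` is a superposition of translations by `c • v` with `c ≥ 0`. As
`𝓕 R` is only a distribution, `R` is first replaced by the Schwartz functions `R(a) (𝓕⁻¹ χ)(r a)`,
whose Fourier transforms vanish on `(-∞, 0)`; they converge to `R` boundedly as `r → 0`. -/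
theorem fourierMultiplier_deformation_eq_zero {V : Type*} [NormedAddCommGroup V]
    [InnerProductSpace ℝ V]
    [FiniteDimensional ℝ V] [MeasurableSpace V] [BorelSpace V] (R : DeformationFunction)
    (v : V) (f : 𝓢(V, ℂ)) (y : V) (h : ∀ c : ℝ, 0 ≤ c → f (y - c • v) = 0) :
    fourierMultiplierCLM ℂ (fun w => R (-2 * Real.pi * inner ℝ w v)) f y = 0 := by
  obtain ⟨χ, hχc, hχ0, hχ1⟩ := exists_cutoff
  have hM : (fun w : V => R (-2 * Real.pi * inner ℝ w v)).HasTemperateGrowth :=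
    R.temperate.comp (by fun_prop)
  have hκ : ∀ r : ℝ, (fun a : ℝ => (𝓕⁻ χ : 𝓢(ℝ, ℂ)) (r * a)).HasTemperateGrowth := fun r =>
    (𝓕⁻ χ : 𝓢(ℝ, ℂ)).hasTemperateGrowth.comp (by fun_prop)
  let r : ℕ → ℝ := fun n => ((n : ℝ) + 1)⁻¹
  have hr : ∀ n, 0 < r n := fun n => by positivity
  let e : ℕ → ℝ ≃L[ℝ] ℝ := fun n =>
    ContinuousLinearEquiv.unitsEquivAut ℝ (Units.mk0 (r n) (hr n).ne')
  let G : ℕ → 𝓢(ℝ, ℂ) := fun n =>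
    smulLeftCLM ℂ R.toFun (compCLMOfContinuousLinearEquiv ℂ (e n) (𝓕⁻ χ))
  have hG : ∀ n a, G n a = R a * 𝓕⁻ (χ : ℝ → ℂ) (r n * a) := by
    intro n a
    rw [SchwartzMap.smulLeftCLM_apply_apply R.temperate, smul_eq_mul, ← SchwartzMap.fourierInv_coe]
    simp [e, mul_comm]
  have hzero : ∀ n, ∫ w : V, Complex.exp (((2 * Real.pi * inner ℝ w y : ℝ) : ℂ) * Complex.I) *
      (G n (-2 * Real.pi * inner ℝ w v) * 𝓕 f w) = 0 := by
    intro n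
    rw [integral_schwartz_comp_inner]
    refine integral_eq_zero_of_ae (ae_of_all _ fun μ => ?_)
    rcases lt_or_ge μ 0 with hμ | hμ
    · simp [fourier_cutoff_eq_zero R χ hχc hχ0 (r n) (hr n) (G n) (hG n) μ hμ]
    · simp [h (2 * Real.pi * μ) (by positivity)]
  obtain ⟨C, hC⟩ := (𝓕⁻ χ : 𝓢(ℝ, ℂ)).decay 0 0
  have hCb : ∀ a, ‖𝓕⁻ (χ : ℝ → ℂ) a‖ ≤ C := by
    intro a
    have := hC.2 a
    simpa [SchwartzMap.fourierInv_coe] using this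
  have hκ0 : 𝓕⁻ (χ : ℝ → ℂ) 0 = 1 := by
    rw [Real.fourierInv_eq']; simpa using hχ1
  have hlim : Tendsto (fun n => ∫ w : V,
      Complex.exp (((2 * Real.pi * inner ℝ w y : ℝ) : ℂ) * Complex.I) *
      (G n (-2 * Real.pi * inner ℝ w v) * 𝓕 f w)) atTop
      (𝓝 (∫ w : V, Complex.exp (((2 * Real.pi * inner ℝ w y : ℝ) : ℂ) * Complex.I) *
      (R (-2 * Real.pi * inner ℝ w v) * 𝓕 f w))) := by
    refine tendsto_integral_of_dominated_convergence (fun w => C * ‖𝓕 f w‖) (fun n => ?_)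
      (((𝓕 f).integrable (μ := volume)).norm.const_mul C) (fun n => ae_of_all _ fun w => ?_)
      (ae_of_all _ fun w => ?_)
    · have h1 := (𝓕 f).continuous
      have h2 := (G n).continuous
      exact Continuous.aestronglyMeasurable (by fun_prop)
    · rw [norm_mul, Complex.norm_exp_ofReal_mul_I, one_mul, norm_mul, hG, norm_mul,
        norm_deformationFunction, one_mul]
      exact mul_le_mul_of_nonneg_right (hCb _) (norm_nonneg _)
    · have hr0 : Tendsto r atTop (𝓝 0) := tendsto_inv_atTop_zero.comp
        (tendsto_atTop_add_const_right _ 1 tendsto_natCast_atTop_atTop)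
      have hcont : Continuous (𝓕⁻ (χ : ℝ → ℂ)) := by
        rw [← SchwartzMap.fourierInv_coe]; exact (𝓕⁻ χ : 𝓢(ℝ, ℂ)).continuous
      have h1 : Tendsto (fun n => 𝓕⁻ (χ : ℝ → ℂ) (r n * (-2 * Real.pi * inner ℝ w v))) atTop
          (𝓝 1) := by
        rw [← hκ0]
        refine (hcont.tendsto 0).comp ?_
        simpa using hr0.mul_const (-2 * Real.pi * inner ℝ w v)
      simp_rw [hG]
      simpa using ((h1.const_mul (R (-2 * Real.pi * inner ℝ w v))).mul_const (𝓕 f w)).const_mul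
        (Complex.exp (((2 * Real.pi * inner ℝ w y : ℝ) : ℂ) * Complex.I))
  simp_rw [hzero] at hlim
  have h0 := tendsto_nhds_unique hlim tendsto_const_nhds
  rw [fourierMultiplierCLM_apply, SchwartzMap.fourierInv_coe, Real.fourierInv_eq', ← h0]
  congr 1
  ext w
  rw [SchwartzMap.smulLeftCLM_apply_apply hM]
  simp

theorem fourierMultiplier_prod_support {V ι : Type*} [NormedAddCommGroup V]
    [InnerProductSpace ℝ V] [FiniteDimensional ℝ V] [MeasurableSpace V] [BorelSpace V]
    (R : DeformationFunction) (t : Finset ι) (v : ι → V) (f : 𝓢(V, ℂ)) (y : V)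
    (h : fourierMultiplierCLM ℂ (fun w => ∏ i ∈ t, R (-2 * Real.pi * inner ℝ w (v i))) f y ≠ 0) :
    ∃ c : ι → ℝ, (∀ i, 0 ≤ c i) ∧ f (y - ∑ i ∈ t, c i • v i) ≠ 0 := by
  classical
  induction t using Finset.induction_on generalizing y with
  | empty =>
    refine ⟨0, fun _ => le_rfl, ?_⟩
    simpa [fourierMultiplierCLM_const] using h
  | insert a t ha ih =>
    have h1 : (fun w : V => R (-2 * Real.pi * inner ℝ w (v a))).HasTemperateGrowth :=
      R.temperate.comp (by fun_prop)
    have h2 : (fun w : V => ∏ i ∈ t, R (-2 * Real.pi * inner ℝ w (v i))).HasTemperateGrowth :=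
      hasTemperateGrowth_prod _ _ fun i _ => R.temperate.comp (by fun_prop)
    have h3 : (fun w : V => ∏ i ∈ insert a t, R (-2 * Real.pi * inner ℝ w (v i))) =
        (fun w : V => R (-2 * Real.pi * inner ℝ w (v a))) *
        (fun w : V => ∏ i ∈ t, R (-2 * Real.pi * inner ℝ w (v i))) := by
      ext w
      simp [Finset.prod_insert ha]
    rw [h3, ← fourierMultiplierCLM_fourierMultiplierCLM_apply h1 h2] at h
    obtain ⟨b, hb, hne⟩ : ∃ b : ℝ, 0 ≤ b ∧ fourierMultiplierCLM ℂ
        (fun w => ∏ i ∈ t, R (-2 * Real.pi * inner ℝ w (v i))) f (y - b • v a) ≠ 0 := by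
      by_contra! hcon
      exact h (fourierMultiplier_deformation_eq_zero R _ _ y hcon)
    obtain ⟨c, hc, hfc⟩ := ih _ hne
    refine ⟨Function.update c a b, fun i => ?_, ?_⟩
    · by_cases hi : i = a
      · subst hi; simpa using hb
      · simpa [hi] using hc i
    · rw [Finset.sum_insert ha, Function.update_self,
        Finset.sum_congr rfl (g := fun i => c i • v i), ← sub_sub]
      · exact hfc
      · intro i hi
        rw [Function.update_of_ne (fun h : i = a => ha (h ▸ hi))]

/-! ### Multipliers and the Fourier transform -/

theorem mdot_comm {s : ℕ} (x y : Spacetime s) : mdot x y = mdot y x := by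
  simp [mdot, mul_comm]

theorem spaceFlip_spaceFlip {s : ℕ} (x : Spacetime s) : spaceFlip s (spaceFlip s x) = x := by
  ext i
  by_cases hi : i = 0 <;> simp [spaceFlip, hi]

theorem fourierScale_symm_apply {s n : ℕ} (w : NPoint s n) (k : Fin n) :
    (fourierScale s n).symm w k = (-2 * Real.pi) • spaceFlip s (w k) := by
  have h : fourierScale s n (WithLp.toLp 2 fun k => (-2 * Real.pi) • spaceFlip s (w k)) = w := by
    refine PiLp.ext fun k => ?_
    change (-(2 * Real.pi)⁻¹ : ℝ) • spaceFlip s ((-2 * Real.pi) • spaceFlip s (w k)) = w k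
    rw [map_smul, spaceFlip_spaceFlip, smul_smul, show -(2 * Real.pi)⁻¹ * (-2 * Real.pi) = 1 by
      field_simp, one_smul]
  rw [(fourierScale s n).symm_apply_eq.2 h.symm]

theorem firstPoints_fourierScale_symm {s m n : ℕ} (w : NPoint s (m + n)) :
    firstPoints s m n ((fourierScale s (m + n)).symm w) =
      (fourierScale s m).symm (firstPoints s m n w) := by
  refine PiLp.ext fun k => ?_
  rw [fourierScale_symm_apply]
  exact fourierScale_symm_apply w _

theorem lastPoints_fourierScale_symm {s m n : ℕ} (w : NPoint s (m + n)) :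
    lastPoints s m n ((fourierScale s (m + n)).symm w) =
      (fourierScale s n).symm (lastPoints s m n w) := by
  refine PiLp.ext fun k => ?_
  rw [fourierScale_symm_apply]
  exact fourierScale_symm_apply w _

theorem mdot_fourierScale_symm {s n : ℕ} (x : Spacetime s) (w : NPoint s n) (k : Fin n) :
    mdot x ((fourierScale s n).symm w k) = -2 * Real.pi * inner ℝ (w k) x := by
  rw [fourierScale_symm_apply, mdot_comm, mdot_eq_inner, map_smul, spaceFlip_spaceFlip,
    inner_smul_right, real_inner_comm]

/-- In terms of Mathlib's Fourier transform, `multiplier M` is a Fourier multiplier; the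
normalization of `momentum` cancels and only its change of variables remains. -/
theorem multiplier_eq_fourierMultiplierCLM {s n : ℕ} {M : NPoint s n → ℂ}
    (hM : M.HasTemperateGrowth) (f : Test s n) :
    multiplier M f = fourierMultiplierCLM ℂ (fun w => M ((fourierScale s n).symm w)) f := by
  have hM' : (fun w => M ((fourierScale s n).symm w)).HasTemperateGrowth :=
    hM.comp (fourierScale s n).symm.toContinuousLinearMap.hasTemperateGrowth
  apply (momentum s n).injective
  ext p
  rw [momentum_multiplier hM]
  have h : ∀ g : Test s n, momentum s n g p = fourierConst s n * 𝓕 g (fourierScale s n p) :=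
    fun g => rfl
  rw [h, h, fourierMultiplierCLM_apply, FourierTransform.fourier_fourierInv_eq,
    smulLeftCLM_apply_apply hM', ContinuousLinearEquiv.symm_apply_apply, smul_eq_mul]
  ring

theorem fourier_multiplier {s n : ℕ} {M : NPoint s n → ℂ} (hM : M.HasTemperateGrowth)
    (f : Test s n) (w : NPoint s n) :
    𝓕 (multiplier M f) w = M ((fourierScale s n).symm w) * 𝓕 f w := by
  have hM' : (fun w => M ((fourierScale s n).symm w)).HasTemperateGrowth :=
    hM.comp (fourierScale s n).symm.toContinuousLinearMap.hasTemperateGrowth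
  rw [multiplier_eq_fourierMultiplierCLM hM, fourierMultiplierCLM_apply,
    FourierTransform.fourier_fourierInv_eq, smulLeftCLM_apply_apply hM', smul_eq_mul]

theorem fourier_injective {s n : ℕ} {f g : Test s n} (h : ∀ w, 𝓕 f w = 𝓕 g w) : f = g := by
  have : (𝓕 f : Test s n) = 𝓕 g := by ext w; exact h w
  rw [← FourierTransform.fourierInv_fourier_eq (F := Test s n) f, this,
    FourierTransform.fourierInv_fourier_eq]

/-- The splitting `ℝ^{(m+n)d} = ℝ^{md} × ℝ^{nd}` into the first `m` and the last `n` points. -/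
def splitPoints (s m n : ℕ) : NPoint s (m + n) ≃ᵐ NPoint s m × NPoint s n :=
  ((LinearIsometryEquiv.piLpCongrLeft 2 ℝ (Spacetime s) finSumFinEquiv.symm).trans
    (PiLp.sumPiLpEquivProdLpPiLp 2 (fun _ : Fin m ⊕ Fin n => Spacetime s))).toMeasurableEquiv.trans
    (MeasurableEquiv.toLp 2 (NPoint s m × NPoint s n)).symm

theorem splitPoints_apply {s m n : ℕ} (x : NPoint s (m + n)) :
    splitPoints s m n x = (firstPoints s m n x, lastPoints s m n x) := rfl

theorem measurePreserving_splitPoints (s m n : ℕ) :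
    MeasurePreserving (splitPoints s m n) volume volume :=
  (LinearIsometryEquiv.measurePreserving _).trans
    (WithLp.volume_preserving_symm_measurableEquiv_toLp_prod _ _)

theorem inner_eq_first_add_last {s m n : ℕ} (x y : NPoint s (m + n)) :
    inner ℝ x y = inner ℝ (firstPoints s m n x) (firstPoints s m n y) +
      inner ℝ (lastPoints s m n x) (lastPoints s m n y) := by
  rw [PiLp.inner_apply, PiLp.inner_apply, PiLp.inner_apply, Fin.sum_univ_add]
  rfl

theorem fourier_tensor {s m n : ℕ} (f : Test s m) (g : Test s n) (w : NPoint s (m + n)) :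
    𝓕 (tensor f g) w = 𝓕 f (firstPoints s m n w) * 𝓕 g (lastPoints s m n w) := by
  rw [SchwartzMap.fourier_coe, SchwartzMap.fourier_coe, SchwartzMap.fourier_coe, Real.fourier_eq',
    Real.fourier_eq', Real.fourier_eq', ← integral_prod_mul, ← Measure.volume_eq_prod,
    ← (measurePreserving_splitPoints s m n).integral_comp']
  congr 1
  ext x
  rw [splitPoints_apply, inner_eq_first_add_last]
  change _ • (f (firstPoints s m n x) * g (lastPoints s m n x)) = _
  simp only [smul_eq_mul, mul_add, Complex.ofReal_add, add_mul, Complex.exp_add]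
  ring

theorem fourier_conjTest {s n : ℕ} (f : Test s n) (w : NPoint s n) :
    𝓕 (conjTest s n f) w = conj (𝓕 f (-w)) := by
  rw [SchwartzMap.fourier_coe, SchwartzMap.fourier_coe, Real.fourier_eq', Real.fourier_eq',
    ← integral_conj]
  congr 1
  ext x
  change _ • conj (f x) = _
  simp only [smul_eq_mul, map_mul, ← Complex.exp_conj, Complex.conj_ofReal, Complex.conj_I]
  congr 2
  rw [inner_neg_right]
  push_cast
  ring

theorem fourier_conjTest_comp {s n : ℕ} (A : NPoint s n ≃ₗᵢ[ℝ] NPoint s n) (f : Test s n)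
    (w : NPoint s n) :
    𝓕 (conjTest s n (compCLMOfContinuousLinearEquiv ℝ A.toContinuousLinearEquiv f)) w =
      conj (𝓕 f (-A w)) := by
  rw [fourier_conjTest, SchwartzMap.fourier_coe, SchwartzMap.fourier_coe, ← map_neg A,
    ← Real.fourier_comp_linearIsometry]
  rfl

theorem fourier_starTest {s n : ℕ} (f : Test s n) (w : NPoint s n) :
    𝓕 (starTest s n f) w = conj (𝓕 f (-WithLp.toLp 2 fun k => w k.rev)) :=
  fourier_conjTest_comp _ f w

theorem fourier_jTest {s n : ℕ} (f : Test s n) (w : NPoint s n) :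
    𝓕 (jTest s n f) w = conj (𝓕 f (-WithLp.toLp 2 fun k => jFlip s (w k))) :=
  fourier_conjTest_comp _ f w

/-! ### Shifts as continuous `*`-automorphisms -/

/-- The symbol of `τ^R_x` on `𝒮ₙ`. -/
def shiftSymbol {s : ℕ} (R : DeformationFunction) (x : Spacetime s) (n : ℕ) (p : NPoint s n) : ℂ :=
  ∏ k, R (mdot x (p k))

theorem shiftSymbol_temperate {s : ℕ} (R : DeformationFunction) (x : Spacetime s) (n : ℕ) :
    (shiftSymbol R x n).HasTemperateGrowth := shift_temperate R x

theorem shift_of {s n : ℕ} (R : DeformationFunction) (x : Spacetime s) (f : Test s n) :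
    shift R x (of s n f) = of s n (multiplier (shiftSymbol R x n) f) :=
  DFinsupp.mapRange_single (hf := fun _ => map_zero (multiplier _))

theorem shiftSymbol_mul_neg {s n : ℕ} (R : DeformationFunction) (x : Spacetime s)
    (p : NPoint s n) : shiftSymbol R x n p * shiftSymbol R (-x) n p = 1 := by
  rw [shiftSymbol, shiftSymbol, ← Finset.prod_mul_distrib]
  refine Finset.prod_eq_one fun k _ => ?_
  rw [show mdot (-x) (p k) = -mdot x (p k) by simp [mdot]; ring, ← R.conj_eq, R.mul_conj]

theorem shift_shift_neg {s : ℕ} (R : DeformationFunction) (x : Spacetime s) (f : BU s) :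
    shift R x (shift R (-x) f) = f := by
  refine DFinsupp.ext fun n => ?_
  exact multiplier_comp (shift_temperate R x) (shift_temperate R (-x)) (shiftSymbol_mul_neg R x) _

/-- The product of the Borchers–Uhlmann algebra as a bilinear map. -/
def mulBilin (s : ℕ) : BU s →ₗ[ℂ] BU s →ₗ[ℂ] BU s :=
  DirectSum.toModule ℂ ℕ (BU s →ₗ[ℂ] BU s) (fun m =>
    LinearMap.flip (DirectSum.toModule ℂ ℕ (Test s m →ₗ[ℂ] BU s) (fun n =>
      LinearMap.flip ((tensorBilin s m n).compr₂ (of s (m + n))))))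

theorem map_mul_of_map_of_mul_of {s : ℕ} (T : BU s →ₗ[ℂ] BU s)
    (h : ∀ m n (f : Test s m) (g : Test s n),
      T (of s m f * of s n g) = T (of s m f) * T (of s n g)) (f g : BU s) :
    T (f * g) = T f * T g := by
  have : (mulBilin s).compr₂ T = (mulBilin s).compl₁₂ T T := by
    refine DirectSum.linearMap_ext ℂ fun m => LinearMap.ext fun f => ?_
    refine DirectSum.linearMap_ext ℂ fun n => LinearMap.ext fun g => ?_
    exact h m n f g
  exact LinearMap.congr_fun₂ this f g

theorem multiplier_tensor {s m n : ℕ} {M : NPoint s m → ℂ} {N : NPoint s n → ℂ}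
    {P : NPoint s (m + n) → ℂ} (hM : M.HasTemperateGrowth) (hN : N.HasTemperateGrowth)
    (hP : P.HasTemperateGrowth)
    (h : ∀ p, P p = M (firstPoints s m n p) * N (lastPoints s m n p)) (f : Test s m)
    (g : Test s n) :
    multiplier P (tensor f g) = tensor (multiplier M f) (multiplier N g) := by
  refine fourier_injective fun w => ?_
  rw [fourier_multiplier hP, fourier_tensor, fourier_tensor, fourier_multiplier hM,
    fourier_multiplier hN, h]
  rw [firstPoints_fourierScale_symm, lastPoints_fourierScale_symm]
  ring

theorem shift_mul {s : ℕ} (R : DeformationFunction) (x : Spacetime s) (f g : BU s) :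
    shift R x (f * g) = shift R x f * shift R x g := by
  refine map_mul_of_map_of_mul_of _ (fun m n f g => ?_) f g
  rw [of_mul_of, shift_of, shift_of, shift_of, of_mul_of,
    multiplier_tensor (shiftSymbol_temperate R x m) (shiftSymbol_temperate R x n)
      (shiftSymbol_temperate R x (m + n)) fun p => Fin.prod_univ_add _]

theorem multiplier_shiftSymbol_starTest {s n : ℕ} (R : DeformationFunction) (x : Spacetime s)
    (f : Test s n) : multiplier (shiftSymbol R x n) (starTest s n f) =
      starTest s n (multiplier (shiftSymbol R x n) f) := by
  have hM := shiftSymbol_temperate R x n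
  refine fourier_injective fun w => ?_
  rw [fourier_multiplier hM, fourier_starTest, fourier_starTest, fourier_multiplier hM, map_mul]
  congr 1
  simp only [shiftSymbol, mdot_fourierScale_symm, map_prod, R.conj_eq]
  refine Fintype.prod_equiv Fin.revPerm _ _ fun k => ?_
  simp

theorem shift_star {s : ℕ} (R : DeformationFunction) (x : Spacetime s) (f : BU s) :
    shift R x (star f) = star (shift R x f) := by
  refine DFinsupp.ext fun n => ?_
  exact multiplier_shiftSymbol_starTest R x (f n)

theorem shift_one {s : ℕ} (R : DeformationFunction) (x : Spacetime s) :
    shift R x 1 = (1 : BU s) := by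
  change shift R x (of s 0 (oneTest s)) = of s 0 (oneTest s)
  rw [shift_of]
  congr 1
  apply (momentum s 0).injective
  ext p
  rw [momentum_multiplier (shiftSymbol_temperate R x 0)]
  simp [shiftSymbol]

/-- A linear map which is continuous in each degree is continuous: for each topology `t` in the
infimum which defines the direct sum topology, the topology induced from `t` along `T` also belongs
to it. -/
theorem continuous_of_graded {s : ℕ} (T : BU s →ₗ[ℂ] BU s)
    (S : ∀ n, Test s n →L[ℂ] Test s n) (h : ∀ n f, T (of s n f) = of s n (S n f)) :
    Continuous T := by
  refine continuous_sInf_rng.2 fun t ht => ?_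
  obtain ⟨h1, h2, h3, h4⟩ := ht
  rw [continuous_iff_le_induced]
  refine sInf_le ⟨fun n => ?_, topologicalAddGroup_induced T, continuousSMul_induced T, ?_⟩
  · refine continuous_induced_rng.2 ?_
    have : T ∘ of s n = of s n ∘ S n := funext (h n)
    rw [this]
    exact (h1 n).comp (S n).continuous
  · exact LocallyConvexSpace.induced (T.restrictScalars ℝ)

theorem continuous_shift {s : ℕ} (R : DeformationFunction) (x : Spacetime s) :
    Continuous (shift R x) :=
  continuous_of_graded _ (fun n => multiplier (shiftSymbol R x n)) fun _ f => shift_of R x f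

/-- `τ^R_x` as a `*`-automorphism of the Borchers–Uhlmann algebra, with inverse `τ^R_{-x}`. -/
def shiftEquiv {s : ℕ} (R : DeformationFunction) (x : Spacetime s) : BU s ≃⋆ₐ[ℂ] BU s where
  toFun := shift R x
  invFun := shift R (-x)
  left_inv f := by simpa using shift_shift_neg R (-x) f
  right_inv f := shift_shift_neg R x f
  map_mul' := shift_mul R x
  map_add' := map_add _
  map_star' := shift_star R x
  map_smul' := map_smul _

/-! ### Supports of shifted functions -/

theorem inner_single_right {s n : ℕ} (w : NPoint s n) (k : Fin n) (x : Spacetime s) :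
    inner ℝ w (PiLp.single 2 k x : NPoint s n) = inner ℝ (w k) x := by
  rw [PiLp.inner_apply, Finset.sum_eq_single k]
  · rw [PiLp.single_eq_same]
  · intro j _ hj
    rw [PiLp.single_eq_of_ne 2 hj, inner_zero_right]
  · simp

theorem mdot_coord_temperate {s n : ℕ} (x : Spacetime s) (k : Fin n) :
    (fun p : NPoint s n => mdot x (p k)).HasTemperateGrowth := by
  have h := hasTemperateGrowth_coord s n k
  exact ((Function.HasTemperateGrowth.const _).mul (h 0)).sub
    (.sum fun i _ => (Function.HasTemperateGrowth.const _).mul (h i.succ))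

theorem prod_mdot_temperate {s n : ℕ} {ι : Type*} (R : DeformationFunction) (t : Finset ι)
    (k : ι → Fin n) (x : ι → Spacetime s) :
    (fun p : NPoint s n => ∏ i ∈ t, R (mdot (x i) (p (k i)))).HasTemperateGrowth :=
  hasTemperateGrowth_prod _ _ fun i _ => R.temperate.comp (mdot_coord_temperate (x i) (k i))

theorem multiplier_prod_support {s n : ℕ} {ι : Type*} (R : DeformationFunction) (t : Finset ι)
    (k : ι → Fin n) (x : ι → Spacetime s) (f : Test s n) (y : NPoint s n)
    (h : multiplier (fun p => ∏ i ∈ t, R (mdot (x i) (p (k i)))) f y ≠ 0) :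
    ∃ c : ι → ℝ, (∀ i, 0 ≤ c i) ∧ f (y - ∑ i ∈ t, c i • PiLp.single 2 (k i) (x i)) ≠ 0 := by
  rw [multiplier_eq_fourierMultiplierCLM (prod_mdot_temperate R t k x)] at h
  have hS : (fun w : NPoint s n => ∏ i ∈ t, R (mdot (x i) ((fourierScale s n).symm w (k i)))) =
      fun w => ∏ i ∈ t, R (-2 * Real.pi * inner ℝ w (PiLp.single 2 (k i) (x i))) := by
    funext w
    refine Finset.prod_congr rfl fun i _ => ?_
    rw [mdot_fourierScale_symm, inner_single_right]
  rw [hS] at h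
  exact fourierMultiplier_prod_support R t _ f y h

/-- Multipliers built from vectors `x i` of a convex cone `K` enlarge the set where a function is
nonzero by at most `K × ⋯ × K`. -/
theorem multiplier_prod_support_cone {s n : ℕ} {ι : Type*} (K : PointedCone ℝ (Spacetime s))
    (R : DeformationFunction) (t : Finset ι)
    (k : ι → Fin n) (x : ι → Spacetime s) (hx : ∀ i ∈ t, x i ∈ K) (f : Test s n) (y : NPoint s n)
    (h : multiplier (fun p => ∏ i ∈ t, R (mdot (x i) (p (k i)))) f y ≠ 0) :
    ∃ z : NPoint s n, (∀ j, z j ∈ K) ∧ f (y - z) ≠ 0 := by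
  obtain ⟨c, hc, hf⟩ := multiplier_prod_support R t k x f y h
  refine ⟨_, fun j => ?_, hf⟩
  rw [WithLp.ofLp_sum, Finset.sum_apply]
  refine Submodule.sum_mem _ fun i hi => ?_
  rw [PiLp.smul_apply]
  refine K.smul_mem (hc i) ?_
  by_cases hj : j = k i
  · subst hj; simpa using hx i hi
  · simp [PiLp.single_eq_of_ne, hj]

/-- Shifts by vectors of the cone `K` keep functions localized in `O`: every closed set of `n`-point
configurations in `O × ⋯ × O` stays, after adding `K × ⋯ × K`, within a closed subset of
`O × ⋯ × O`. The intermediate closed set matters for open `O`, where `O + K ⊆ O` does not control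
the limit points. -/
def KeepsLocal {s : ℕ} (O : Set (Spacetime s)) (K : PointedCone ℝ (Spacetime s)) : Prop :=
  ∀ (n : ℕ) (S : Set (NPoint s n)), IsClosed S → (∀ x ∈ S, ∀ k, x k ∈ O) →
    ∃ S' : Set (NPoint s n), IsClosed S' ∧ (∀ x ∈ S', ∀ k, x k ∈ O) ∧
      ∀ y z : NPoint s n, (∀ k, z k ∈ K) → y - z ∈ S → y ∈ S'

theorem KeepsLocal.of_isClosed {s : ℕ} {O : Set (Spacetime s)} {K : PointedCone ℝ (Spacetime s)}
    (hO : IsClosed O) (hOK : ∀ x ∈ O, ∀ z ∈ K, x + z ∈ O) : KeepsLocal O K := by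
  intro n S _ hSO
  refine ⟨{x | ∀ k, x k ∈ O}, ?_, fun x hx => hx, fun y z hz hyz k => ?_⟩
  · rw [Set.ofPred_forall]
    exact isClosed_iInter fun k => hO.preimage (PiLp.continuous_apply 2 _ k)
  · simpa using hOK _ (hSO _ hyz k) (z k) (hz k)

/-- If a linear form `ℓ` is nonnegative on `O` and controls the norm on the closed cone `K`, then
the sum of a closed subset of `O × ⋯ × O` and `K × ⋯ × K` is closed: along a convergent sequence
`yⱼ = cⱼ + zⱼ` of such sums, `ℓ(zⱼ) ≤ ℓ(yⱼ)` bounds the `zⱼ`, and compactness applies. -/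
theorem KeepsLocal.of_norm_le {s : ℕ} {O : Set (Spacetime s)} {K : PointedCone ℝ (Spacetime s)}
    (hK : IsClosed (K : Set (Spacetime s))) (hOK : ∀ x ∈ O, ∀ z ∈ K, x + z ∈ O)
    (ℓ : Spacetime s →L[ℝ] ℝ) (hO : ∀ x ∈ O, 0 ≤ ℓ x) (C : ℝ) (hC0 : 0 ≤ C)
    (hC : ∀ z ∈ K, ‖z‖ ≤ C * ℓ z) : KeepsLocal O K := by
  intro n S hS hSO
  refine ⟨{y | ∃ z : NPoint s n, (∀ k, z k ∈ K) ∧ y - z ∈ S}, ?_, ?_,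
    fun y z hz hyz => ⟨z, hz, hyz⟩⟩
  · refine IsSeqClosed.isClosed fun y a hy hya => ?_
    choose z hzK hzS using hy
    obtain ⟨B, hB⟩ := (Metric.isBounded_range_of_tendsto y hya).exists_norm_le
    have hz : ∀ j k, ‖z j k‖ ≤ C * (‖ℓ‖ * B) := by
      intro j k
      have h1 := hO _ (hSO _ (hzS j) k)
      rw [PiLp.sub_apply, map_sub] at h1
      have h2 : ℓ (y j k) ≤ ‖ℓ‖ * B := (le_abs_self _).trans ((ℓ.le_opNorm _).trans
        (mul_le_mul_of_nonneg_left ((PiLp.norm_apply_le (y j) k).trans (hB _ ⟨j, rfl⟩))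
          (norm_nonneg _)))
      exact (hC _ (hzK j k)).trans (mul_le_mul_of_nonneg_left (by linarith) hC0)
    have hbd : ∀ j, z j ∈ Metric.closedBall (0 : NPoint s n)
        (Real.sqrt (∑ _k : Fin n, (C * (‖ℓ‖ * B)) ^ 2)) := by
      intro j
      rw [mem_closedBall_zero_iff]
      refine Real.le_sqrt_of_sq_le ?_
      rw [PiLp.norm_sq_eq_of_L2]
      exact Finset.sum_le_sum fun k _ => pow_le_pow_left₀ (norm_nonneg _) (hz j k) 2
    obtain ⟨b, -, φ, hφ, hzb⟩ := (isCompact_closedBall _ _).tendsto_subseq hbd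
    refine ⟨b, fun k => ?_, ?_⟩
    · exact hK.mem_of_tendsto (((PiLp.continuous_apply 2 _ k).tendsto b).comp hzb)
        (Eventually.of_forall fun j => hzK _ k)
    · exact hS.mem_of_tendsto ((hya.comp hφ.tendsto_atTop).sub hzb)
        (Eventually.of_forall fun j => hzS _)
  · rintro y ⟨z, hz, hyz⟩ k
    simpa using hOK _ (hSO _ hyz k) (z k) (hz k)

theorem KeepsLocal.exists_closed {s : ℕ} {O : Set (Spacetime s)}
    {K : PointedCone ℝ (Spacetime s)} (h : KeepsLocal O K) {D : Set (Spacetime s)}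
    (hD : IsClosed D) (hDO : D ⊆ O) :
    ∃ D', IsClosed D' ∧ D' ⊆ O ∧ ∀ y, ∀ z ∈ K, y - z ∈ D → y ∈ D' := by
  obtain ⟨S', hS', hSO, hS⟩ := h 1 {x | x 0 ∈ D} (hD.preimage (PiLp.continuous_apply 2 _ 0))
    (fun x hx k => by rw [Subsingleton.elim k 0]; exact hDO hx)
  refine ⟨{y | WithLp.toLp 2 (fun _ => y) ∈ S'}, hS'.preimage ?_, fun y hy => hSO _ hy 0,
    fun y z hz hyz => hS _ (WithLp.toLp 2 fun _ => z) (fun _ => hz) hyz⟩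
  exact (PiLp.continuous_toLp 2 _).comp (continuous_pi fun _ => continuous_id)

theorem KeepsLocal.mem_localTest {s n : ℕ} {O : Set (Spacetime s)}
    {K : PointedCone ℝ (Spacetime s)} (h : KeepsLocal O K) {f g : Test s n}
    (hf : f ∈ localTest n O)
    (hfg : ∀ y, g y ≠ 0 → ∃ z : NPoint s n, (∀ k, z k ∈ K) ∧ f (y - z) ≠ 0) :
    g ∈ localTest n O := by
  obtain ⟨S', hS', hSO, hS⟩ := h n (tsupport f) (isClosed_tsupport f) hf
  refine fun x hx => hSO x (closure_minimal (fun y hy => ?_) hS' hx)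
  obtain ⟨z, hz, hyz⟩ := hfg y hy
  exact hS y z hz (subset_tsupport _ hyz)

theorem mem_localAlgebra_iff {s : ℕ} {O : Set (Spacetime s)} {f : BU s} :
    f ∈ localAlgebra O ↔ ∃ D ⊆ O, IsClosed D ∧ ∀ n, 1 ≤ n → f n ∈ localTest n D := by
  constructor
  · intro hf
    refine ⟨supp f, hf, isClosed_sInter fun _ h => h.1, fun n hn x hx k => ?_⟩
    exact Set.mem_sInter.2 fun D hD => hD.2 n hn hx k
  · rintro ⟨D, hDO, hD, h⟩
    exact Set.Subset.trans (Set.sInter_subset_of_mem (Set.mem_ofPred.2 ⟨hD, h⟩)) hDO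

theorem shift_support {s n : ℕ} {K : PointedCone ℝ (Spacetime s)} (R : DeformationFunction)
    {x : Spacetime s} (hx : x ∈ K) (f : BU s) (y : NPoint s n) (h : shift R x f n y ≠ 0) :
    ∃ z : NPoint s n, (∀ k, z k ∈ K) ∧ f n (y - z) ≠ 0 :=
  multiplier_prod_support_cone K R Finset.univ id (fun _ => x) (fun _ _ => hx) (f n) y h

theorem KeepsLocal.shift_mem_localTest {s n : ℕ} {O : Set (Spacetime s)}
    {K : PointedCone ℝ (Spacetime s)} (h : KeepsLocal O K) (R : DeformationFunction)
    {x : Spacetime s} (hx : x ∈ K) {f : BU s} (hf : f n ∈ localTest n O) :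
    shift R x f n ∈ localTest n O :=
  h.mem_localTest hf (shift_support R hx f)

theorem KeepsLocal.shift_mem_localAlgebra {s : ℕ} {O : Set (Spacetime s)}
    {K : PointedCone ℝ (Spacetime s)} (h : KeepsLocal O K) (R : DeformationFunction)
    {x : Spacetime s} (hx : x ∈ K) {f : BU s} (hf : f ∈ localAlgebra O) :
    shift R x f ∈ localAlgebra O := by
  obtain ⟨D, hDO, hD, hfD⟩ := mem_localAlgebra_iff.1 hf
  obtain ⟨D', hD', hDO', hDD'⟩ := h.exists_closed hD hDO
  refine mem_localAlgebra_iff.2 ⟨D', hDO', hD', fun n hn x hx => ?_⟩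
  refine closure_minimal (t := {x : NPoint s n | ∀ k, x k ∈ D'}) (fun y hy => ?_) ?_ hx
  · obtain ⟨z, hz, hyz⟩ := shift_support R ‹_› f y hy
    exact fun k => hDD' _ (z k) (hz k) (hfD n hn (subset_tsupport _ hyz) k)
  · rw [Set.ofPred_forall]
    exact isClosed_iInter fun k => hD'.preimage (PiLp.continuous_apply 2 _ k)

/-! ### Wedges -/

theorem isClosed_closedWedge (s : ℕ) : IsClosed {x : Spacetime s | |x 0| ≤ x 1} :=
  isClosed_le (PiLp.continuous_apply 2 _ 0).abs (PiLp.continuous_apply 2 _ 1)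

theorem closure_rightWedge (s : ℕ) : closure (rightWedge s) = {x | |x 0| ≤ x 1} := by
  refine subset_antisymm
    (closure_minimal (fun x hx => (le_of_lt hx : |x 0| ≤ x 1)) (isClosed_closedWedge s))
    fun x hx => ?_
  have hcont : Continuous fun ε : ℝ => x + ε • (PiLp.single 2 1 1 : Spacetime s) := by fun_prop
  have h0 : Tendsto (fun ε : ℝ => x + ε • (PiLp.single 2 1 1 : Spacetime s)) (𝓝[>] 0) (𝓝 x) := by
    have := (hcont.tendsto 0).mono_left (nhdsWithin_le_nhds (s := Set.Ioi 0))
    simpa using this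
  refine mem_closure_of_tendsto h0 ?_
  filter_upwards [self_mem_nhdsWithin] with ε hε
  have hε' : 0 < ε := hε
  have hx' : |x 0| ≤ x 1 := hx
  simp only [rightWedge, Set.mem_ofPred_eq, PiLp.add_apply, PiLp.smul_apply]
  simp
  linarith

/-- The closure of the right wedge `W₀`, as a cone. -/
def wedgeCone (s : ℕ) : PointedCone ℝ (Spacetime s) where
  carrier := {x | |x 0| ≤ x 1}
  add_mem' {x y} hx hy := by
    have hx' : |x 0| ≤ x 1 := hx
    have hy' : |y 0| ≤ y 1 := hy
    exact ((abs_add_le _ _).trans (add_le_add hx' hy') : |x 0 + y 0| ≤ x 1 + y 1)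
  zero_mem' := by simp
  smul_mem' c x hx := by
    change |(c : ℝ) * x 0| ≤ (c : ℝ) * x 1
    rw [abs_mul, abs_of_nonneg c.2]
    exact mul_le_mul_of_nonneg_left hx c.2

theorem mem_wedgeCone {s : ℕ} {x : Spacetime s} : x ∈ wedgeCone s ↔ |x 0| ≤ x 1 := Iff.rfl

theorem mem_wedgeCone_iff {s : ℕ} {x : Spacetime s} :
    x ∈ wedgeCone s ↔ x ∈ closure (rightWedge s) := by
  rw [closure_rightWedge]; rfl

/-- The vectors `x` of the closed wedge with `‖x‖ ≤ C x¹`. Such a cone meets the edge only in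
`0`. -/
def narrowCone (s : ℕ) (C : ℝ) : PointedCone ℝ (Spacetime s) where
  carrier := {x | x ∈ wedgeCone s ∧ ‖x‖ ≤ C * x 1}
  add_mem' {x y} hx hy := ⟨add_mem hx.1 hy.1, (norm_add_le _ _).trans (by
    rw [PiLp.add_apply, mul_add]; exact add_le_add hx.2 hy.2)⟩
  zero_mem' := ⟨zero_mem _, by simp⟩
  smul_mem' c x hx := ⟨Submodule.smul_mem _ c hx.1, by
    change ‖(c : ℝ) • x‖ ≤ C * ((c : ℝ) * x 1)
    rw [norm_smul, Real.norm_of_nonneg c.2, mul_left_comm]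
    exact mul_le_mul_of_nonneg_left hx.2 c.2⟩

theorem isClosed_narrowCone (s : ℕ) (C : ℝ) : IsClosed (narrowCone s C : Set (Spacetime s)) :=
  IsClosed.inter (s₁ := {x : Spacetime s | |x 0| ≤ x 1}) (s₂ := {x | ‖x‖ ≤ C * x 1})
    (isClosed_closedWedge s)
    (isClosed_le continuous_norm (continuous_const.mul (PiLp.continuous_apply 2 _ 1)))

theorem rightWedge_add {s : ℕ} {x z : Spacetime s} (hx : x ∈ rightWedge s) (hz : z ∈ wedgeCone s) :
    x + z ∈ rightWedge s := by
  have hx' : |x 0| < x 1 := hx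
  have hz' : |z 0| ≤ z 1 := hz
  exact ((abs_add_le _ _).trans_lt (add_lt_add_of_lt_of_le hx' hz') : |x 0 + z 0| < x 1 + z 1)

theorem keepsLocal_rightWedge (s : ℕ) {C : ℝ} (hC : 0 ≤ C) :
    KeepsLocal (rightWedge s) (narrowCone s C) :=
  .of_norm_le (isClosed_narrowCone s C) (fun _ hx _ hz => rightWedge_add hx hz.1)
    (PiLp.proj 2 _ 1) (fun _ hx => (abs_nonneg _).trans (le_of_lt hx)) C hC fun _ hz => hz.2

theorem keepsLocal_neg_rightWedge (s : ℕ) {C : ℝ} (hC : 0 ≤ C) :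
    KeepsLocal (-rightWedge s) (-narrowCone s C) :=
  .of_norm_le (isClosed_narrowCone s C).neg (fun x hx z hz => by
      rw [Set.mem_neg, neg_add]
      exact rightWedge_add hx hz.1)
    (-PiLp.proj 2 _ 1) (fun x hx => (abs_nonneg _).trans (le_of_lt hx)) C hC fun z hz => by
      rw [← norm_neg]; exact hz.2

theorem keepsLocal_translate_closure {s : ℕ} (a : Spacetime s) :
    KeepsLocal {y | y - a ∈ closure (rightWedge s)} (wedgeCone s) := by
  refine .of_isClosed (isClosed_closure.preimage (by fun_prop)) fun x hx z hz => ?_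
  rw [Set.mem_ofPred_eq, ← mem_wedgeCone_iff] at hx ⊢
  rw [add_sub_right_comm]
  exact add_mem hx hz

theorem mem_closure_neg_rightWedge {s : ℕ} {x : Spacetime s} :
    x ∈ closure (-rightWedge s) ↔ -x ∈ wedgeCone s := by
  rw [mem_wedgeCone_iff, ← Set.mem_neg, ← Set.image_neg_eq_neg, ← Set.image_neg_eq_neg]
  exact Set.ext_iff.1 ((Homeomorph.neg (Spacetime s)).image_closure (rightWedge s)).symm x

theorem keepsLocal_translate_closure_neg {s : ℕ} (a : Spacetime s) :
    KeepsLocal {y | y - a ∈ closure (-rightWedge s)} (-wedgeCone s) := by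
  refine .of_isClosed (isClosed_closure.preimage (by fun_prop)) fun x hx z hz => ?_
  rw [Set.mem_ofPred_eq, mem_closure_neg_rightWedge] at hx ⊢
  rw [add_sub_right_comm, neg_add]
  exact add_mem hx hz

theorem exists_mem_narrowCone {s : ℕ} {x : Spacetime s} (hx : x ∈ closure (rightWedge s))
    (h : x ∈ edge s → x = 0) : ∃ C, 0 ≤ C ∧ x ∈ narrowCone s C := by
  rw [← mem_wedgeCone_iff] at hx
  have hx1 : |x 0| ≤ x 1 := hx
  rcases ((abs_nonneg _).trans hx1).eq_or_lt with h0 | h0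
  · refine ⟨0, le_rfl, ?_⟩
    rw [h ⟨abs_nonpos_iff.1 (h0 ▸ hx1), h0.symm⟩]
    exact zero_mem _
  · refine ⟨‖x‖ / x 1, by positivity, hx, ?_⟩
    rw [div_mul_cancel₀ _ h0.ne']

/-! ### Admissible matrices -/

theorem norm_act_le {s : ℕ} (Q : Matrix (Fin (s + 2)) (Fin (s + 2)) ℝ) :
    ∃ D : ℝ, 0 ≤ D ∧ ∀ p, ‖act Q p‖ ≤ D * ‖p‖ :=
  ⟨_, norm_nonneg _, (Matrix.toEuclideanCLM (n := Fin (s + 2)) (𝕜 := ℝ) Q).le_opNorm⟩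

theorem act_neg {s : ℕ} (Q : Matrix (Fin (s + 2)) (Fin (s + 2)) ℝ) (p : Spacetime s) :
    act Q (-p) = -act Q p := by
  ext i
  simp [act, Matrix.mulVec_neg]

theorem mdot_self {s : ℕ} (p : Spacetime s) : mdot p p = 2 * p 0 ^ 2 - ‖p‖ ^ 2 := by
  rw [EuclideanSpace.real_norm_sq_eq, Fin.sum_univ_succ, mdot]
  simp only [pow_two]
  ring

theorem norm_le_of_mem_forwardCone {s : ℕ} {p : Spacetime s} (hp : p ∈ forwardCone s) :
    ‖p‖ ≤ 2 * p 0 := by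
  have h1 : 0 ≤ mdot p p := hp.1
  have h2 : 0 ≤ p 0 := hp.2
  rw [mdot_self] at h1
  refine le_of_sq_le_sq ?_ (by positivity)
  nlinarith

theorem eq_zero_of_mul_le_mul_sq {b κ : ℝ} (h : ∀ t : ℝ, b * t ≤ κ * t ^ 2) : b = 0 := by
  have hk : 0 < |κ| + 1 := by positivity
  have h1 := h (b / (|κ| + 1))
  have h2 : b * (b / (|κ| + 1)) * (|κ| + 1) ^ 2 ≤ κ * (b / (|κ| + 1)) ^ 2 * (|κ| + 1) ^ 2 :=
    mul_le_mul_of_nonneg_right h1 (by positivity)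
  have h3 : b * (b / (|κ| + 1)) * (|κ| + 1) ^ 2 = b ^ 2 * (|κ| + 1) := by field_simp
  have h4 : κ * (b / (|κ| + 1)) ^ 2 * (|κ| + 1) ^ 2 = κ * b ^ 2 := by field_simp
  rw [h3, h4] at h2
  nlinarith [le_abs_self κ, sq_nonneg b]

/-- The light-like vector `(1 + t², ε (1 - t²), 0, …, 2t, …, 0)` for `ε = ±1`, with `2t` at the
coordinate `i + 2`. Near `t = 0` it runs through the directions close to `e₀ ± e₁`. -/
def nullVector {s : ℕ} (ε t : ℝ) (i : Fin s) : Spacetime s :=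
  WithLp.toLp 2 (Fin.cons (1 + t ^ 2) (Fin.cons (ε * (1 - t ^ 2)) (Pi.single i (2 * t))))

theorem nullVector_mem_forwardCone {s : ℕ} {ε : ℝ} (hε : ε ^ 2 = 1) (t : ℝ) (i : Fin s) :
    nullVector ε t i ∈ forwardCone s := by
  refine ⟨?_, ?_⟩
  · rw [mdot, Fin.sum_univ_succ]
    simp only [nullVector, Fin.cons_zero, Fin.cons_succ]
    rw [Finset.sum_eq_single i (fun j _ hj => by simp [hj]) (by simp), Pi.single_eq_same]
    nlinarith
  · change 0 ≤ 1 + t ^ 2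
    positivity

theorem act_nullVector {s : ℕ} (Q : Matrix (Fin (s + 2)) (Fin (s + 2)) ℝ) (ε t : ℝ) (i : Fin s)
    (j : Fin (s + 2)) :
    act Q (nullVector ε t i) j = Q j 0 * (1 + t ^ 2) + Q j 1 * (ε * (1 - t ^ 2)) +
      Q j i.succ.succ * (2 * t) := by
  simp only [act, Matrix.mulVec, dotProduct, nullVector]
  rw [Fin.sum_univ_succ, Fin.sum_univ_succ]
  simp only [Fin.cons_zero, Fin.cons_succ]
  rw [Finset.sum_eq_single i (fun j _ hj => by simp [hj]) (by simp), Pi.single_eq_same,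
    ← add_assoc]
  rfl

/-- `(Qp)¹ = Q¹₀ p⁰` for admissible `Q`. Antisymmetry gives `Q⁰₀ = Q¹₁ = 0` and `Q⁰₁ = Q¹₀`. The
inequality `|(Qp)⁰| ≤ (Qp)¹` is an equality at `p = e₀ ± e₁`; comparing first order terms in `t`
along the light-like vectors `nullVector (±1) t i` gives `Q¹ᵢ = Q⁰ᵢ = -Q¹ᵢ` for `i ≥ 2`. -/
theorem IsAdmissible.act_one {s : ℕ} {Q : Matrix (Fin (s + 2)) (Fin (s + 2)) ℝ}
    (hQ : IsAdmissible Q) (p : Spacetime s) : act Q p 1 = Q 1 0 * p 0 := by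
  have hact : ∀ i j : Fin (s + 2), act Q (PiLp.single 2 j 1) i = Q i j := by
    intro i j
    simp [act]
  have h0 : ∀ x : Spacetime s, mdot (PiLp.single 2 0 1) x = x 0 := by
    intro x; simp [mdot]
  have h1 : ∀ x : Spacetime s, mdot (PiLp.single 2 1 1) x = -x 1 := by
    intro x
    rw [mdot, Fin.sum_univ_succ]
    simp [Fin.ext_iff]
  have q00 : Q 0 0 = 0 := by
    have h := hQ.antisymm (PiLp.single 2 0 1) (PiLp.single 2 0 1)
    rw [mdot_comm (act Q _), h0, hact] at h
    linarith
  have q11 : Q 1 1 = 0 := by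
    have h := hQ.antisymm (PiLp.single 2 1 1) (PiLp.single 2 1 1)
    rw [mdot_comm (act Q _), h1, hact] at h
    linarith
  have q01 : Q 0 1 = Q 1 0 := by
    have h := hQ.antisymm (PiLp.single 2 0 1) (PiLp.single 2 1 1)
    rw [mdot_comm (act Q _), h0, h1, hact, hact] at h
    linarith
  have hi : ∀ i : Fin s, Q 1 i.succ.succ = 0 := by
    intro i
    have key : ∀ ε : ℝ, ε ^ 2 = 1 → ∀ t : ℝ,
        |Q 1 0 * (ε * (1 - t ^ 2)) + Q 0 i.succ.succ * (2 * t)| ≤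
        Q 1 0 * (1 + t ^ 2) + Q 1 i.succ.succ * (2 * t) := by
      intro ε hε t
      have h := mem_wedgeCone.1 (mem_wedgeCone_iff.2
        (hQ.map_cone _ (nullVector_mem_forwardCone hε t i)))
      rwa [act_nullVector, act_nullVector, q00, q11, q01, zero_mul, zero_mul, zero_add,
        add_zero] at h
    -- `ε = 1` and the upper bound, `ε = -1` and the lower bound: the terms of order zero cancel.
    have e1 : Q 0 i.succ.succ - Q 1 i.succ.succ = 0 :=
      eq_zero_of_mul_le_mul_sq (κ := Q 1 0) fun t => by
        have := (abs_le.1 (key 1 (by norm_num) t)).2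
        linarith
    have e2 : -Q 0 i.succ.succ - Q 1 i.succ.succ = 0 :=
      eq_zero_of_mul_le_mul_sq (κ := Q 1 0) fun t => by
        have := (abs_le.1 (key (-1) (by norm_num) t)).1
        linarith
    linarith
  simp only [act, Matrix.mulVec, dotProduct]
  rw [Fin.sum_univ_succ, Fin.sum_univ_succ, Finset.sum_eq_zero fun i _ => by rw [hi, zero_mul],
    show (0 : Fin (s + 1)).succ = (1 : Fin (s + 2)) from rfl, q11]
  ring

/-- If `Q` maps no vector of the closed forward cone to a nonzero vector of the edge, then the image
of this cone under `Q` is contained in a `narrowCone`. For `Q¹₀ > 0` this follows from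
`‖p‖ ≤ 2 p⁰` on the cone; for `Q¹₀ = 0` the image lies in the edge, so it is `{0}`. -/
theorem IsAdmissible.exists_narrowCone {s : ℕ} {Q : Matrix (Fin (s + 2)) (Fin (s + 2)) ℝ}
    (hQ : IsAdmissible Q) (h : ∀ p ∈ forwardCone s, act Q p ∈ edge s → act Q p = 0) :
    ∃ C, 0 ≤ C ∧ ∀ p ∈ forwardCone s, act Q p ∈ narrowCone s C := by
  have hw : ∀ p ∈ forwardCone s, act Q p ∈ wedgeCone s := fun p hp =>
    mem_wedgeCone_iff.2 (hQ.map_cone p hp)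
  have h10 : 0 ≤ Q 1 0 := by
    have he : (PiLp.single 2 0 1 : Spacetime s) ∈ forwardCone s := by
      constructor <;> simp [mdot]
    have h1 := (abs_nonneg _).trans (mem_wedgeCone.1 (hw _ he))
    rw [hQ.act_one] at h1
    simpa using h1
  rcases h10.eq_or_lt with h10 | h10
  · refine ⟨0, le_rfl, fun p hp => ?_⟩
    have h1 : act Q p 1 = 0 := by rw [hQ.act_one, ← h10, zero_mul]
    have h2 := mem_wedgeCone.1 (hw p hp)
    rw [h1] at h2
    rw [h p hp ⟨abs_nonpos_iff.1 h2, h1⟩]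
    exact zero_mem _
  · obtain ⟨D, hD, hDp⟩ := norm_act_le Q
    refine ⟨2 * D / Q 1 0, by positivity, fun p hp => ⟨hw p hp, ?_⟩⟩
    rw [hQ.act_one, ← mul_assoc, div_mul_cancel₀ _ h10.ne']
    calc ‖act Q p‖ ≤ D * ‖p‖ := hDp p
      _ ≤ D * (2 * p 0) := mul_le_mul_of_nonneg_left (norm_le_of_mem_forwardCone hp) hD
      _ = 2 * D * p 0 := by ring

/-! ### Deformed products -/

/-- `ρ_{m+n}` differs from `ρ_m ⊗ ρ_n` by the two-point factors which join the first `m` to the last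
`n` momenta. -/
theorem rhoN_add {s m n : ℕ} (R : DeformationFunction) (Q : Matrix (Fin (s + 2)) (Fin (s + 2)) ℝ)
    (p : NPoint s (m + n)) :
    rhoN R Q (m + n) p = rhoN R Q m (firstPoints s m n p) * rhoN R Q n (lastPoints s m n p) *
      ∏ l : Fin m, ∏ r : Fin n, rho2 R Q (p (Fin.castAdd n l)) (p (Fin.natAdd m r)) := by
  have hI : ∀ (k : ℕ) (l : Fin k) (F : Fin k → ℂ),
      ∏ r ∈ Finset.Ioi l, F r = ∏ r, if l < r then F r else 1 := by
    intro k l F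
    rw [← Finset.prod_filter]
    congr 1
    ext r
    simp
  have h1 : ∀ (l : Fin m) (r : Fin n), Fin.castAdd n l < Fin.natAdd m r := fun l r => by
    rw [Fin.lt_def]; simp only [Fin.val_castAdd, Fin.val_natAdd]; omega
  have h2 : ∀ (l : Fin m) (r : Fin n), ¬ Fin.natAdd m r < Fin.castAdd n l := fun l r =>
    (h1 l r).le.not_gt
  have h3 : ∀ l r : Fin m, Fin.castAdd n l < Fin.castAdd n r ↔ l < r := fun l r => Iff.rfl
  have h4 : ∀ l r : Fin n, Fin.natAdd m l < Fin.natAdd m r ↔ l < r := fun l r => by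
    rw [Fin.lt_def, Fin.lt_def]; simp
  simp only [rhoN, hI, Fin.prod_univ_add, h1, h2, h3, h4, if_true, if_false,
    Finset.prod_const_one, Finset.prod_mul_distrib]
  rw [mul_one]
  exact (mul_left_comm _ _ _).trans (mul_comm _ _)

theorem rho_of {s n : ℕ} (R : DeformationFunction) (Q : Matrix (Fin (s + 2)) (Fin (s + 2)) ℝ)
    (f : Test s n) : (rho R Q).toEquiv (of s n f) = of s n (multiplier (rhoN R Q n) f) :=
  DFinsupp.mapRange_single (hf := fun _ => map_zero (multiplier _))

theorem rho_symm_of {s n : ℕ} (R : DeformationFunction)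
    (Q : Matrix (Fin (s + 2)) (Fin (s + 2)) ℝ) (f : Test s n) :
    (rho R Q).toEquiv.symm (of s n f) = of s n (multiplier (rhoN R (-Q) n) f) :=
  DFinsupp.mapRange_single (hf := fun _ => map_zero (multiplier _))

/-- The deformed product `f ⊗_ρ g` of `f ∈ 𝒮_m` and `g ∈ 𝒮_n` as an element of `𝒮_{m+n}`. -/
def deformedTensor {s m n : ℕ} (R : DeformationFunction)
    (Q : Matrix (Fin (s + 2)) (Fin (s + 2)) ℝ) (f : Test s m) (g : Test s n) : Test s (m + n) :=
  multiplier (rhoN R (-Q) (m + n))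
    (tensor (multiplier (rhoN R Q m) f) (multiplier (rhoN R Q n) g))

theorem deformedMul_of_of {s m n : ℕ} (R : DeformationFunction)
    (Q : Matrix (Fin (s + 2)) (Fin (s + 2)) ℝ) (f : Test s m) (g : Test s n) :
    deformedMul (rho R Q).toEquiv (of s m f) (of s n g) =
      of s (m + n) (deformedTensor R Q f g) := by
  rw [deformedMul, rho_of, rho_of, of_mul_of, rho_symm_of, deformedTensor]

theorem rho2_neg {s : ℕ} (R : DeformationFunction) (Q : Matrix (Fin (s + 2)) (Fin (s + 2)) ℝ)
    (p q : Spacetime s) : rho2 R (-Q) p q = R (mdot p (act Q q)) := by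
  rw [rho2]
  congr 1
  simp [mdot, act, Matrix.neg_mulVec]
  ring

/-- In momentum space `f ⊗_ρ g` is `f̃ ⊗ g̃` times the factors `R(p_l · Q p_r)` which join a
momentum of `f` to a momentum of `g`. -/
theorem fourier_deformedTensor {s m n : ℕ} (R : DeformationFunction)
    (Q : Matrix (Fin (s + 2)) (Fin (s + 2)) ℝ) (f : Test s m) (g : Test s n)
    (w : NPoint s (m + n)) :
    𝓕 (deformedTensor R Q f g) w =
      (∏ l : Fin m, ∏ r : Fin n,
        R (mdot ((fourierScale s m).symm (firstPoints s m n w) l)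
          (act Q ((fourierScale s n).symm (lastPoints s m n w) r)))) *
      (𝓕 f (firstPoints s m n w) * 𝓕 g (lastPoints s m n w)) := by
  rw [deformedTensor, fourier_multiplier (rhoN_temperate R _ _), fourier_tensor,
    fourier_multiplier (rhoN_temperate R _ _), fourier_multiplier (rhoN_temperate R _ _),
    rhoN_add, firstPoints_fourierScale_symm, lastPoints_fourierScale_symm]
  have h1 := rhoN_mul_rhoN_neg R Q m ((fourierScale s m).symm (firstPoints s m n w))
  have h2 := rhoN_mul_rhoN_neg R Q n ((fourierScale s n).symm (lastPoints s m n w))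
  have hp : ∀ l : Fin m, (fourierScale s (m + n)).symm w (Fin.castAdd n l) =
      (fourierScale s m).symm (firstPoints s m n w) l := fun l => by
    rw [← firstPoints_fourierScale_symm]; rfl
  have hq : ∀ r : Fin n, (fourierScale s (m + n)).symm w (Fin.natAdd m r) =
      (fourierScale s n).symm (lastPoints s m n w) r := fun l => by
    rw [← lastPoints_fourierScale_symm]; rfl
  simp only [rho2_neg, hp, hq]
  set P := ∏ l : Fin m, ∏ r : Fin n, R (mdot ((fourierScale s m).symm (firstPoints s m n w) l)
    (act Q ((fourierScale s n).symm (lastPoints s m n w) r)))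
  set A := rhoN R Q m ((fourierScale s m).symm (firstPoints s m n w))
  set A' := rhoN R (-Q) m ((fourierScale s m).symm (firstPoints s m n w))
  linear_combination (P * 𝓕 f (firstPoints s m n w) * 𝓕 g (lastPoints s m n w)) *
    (A * A' * h2 + h1)

theorem integrable_exp_mul_fourier {s n : ℕ} (f : Test s n) (x : NPoint s n) :
    Integrable fun w =>
      Complex.exp (((2 * Real.pi * inner ℝ w x : ℝ) : ℂ) * Complex.I) * 𝓕 f w := by
  refine ((𝓕 f).integrable (μ := volume)).mono (Continuous.aestronglyMeasurable ?_)
    (ae_of_all _ fun w => ?_)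
  · have := (𝓕 f).continuous
    fun_prop
  · rw [norm_mul, Complex.norm_exp_ofReal_mul_I, one_mul]

theorem eq_integral_splitPoints {s m n : ℕ} (G : Test s (m + n)) (y : NPoint s (m + n))
    (Φ : NPoint s m × NPoint s n → ℂ)
    (hΦ : ∀ w, Complex.exp (((2 * Real.pi * inner ℝ w y : ℝ) : ℂ) * Complex.I) * 𝓕 G w =
      Φ (firstPoints s m n w, lastPoints s m n w)) :
    Integrable Φ (volume.prod volume) ∧ G y = ∫ z, Φ z ∂(volume.prod volume) := by
  have hΦ' : (fun w => Complex.exp (((2 * Real.pi * inner ℝ w y : ℝ) : ℂ) * Complex.I) * 𝓕 G w) =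
      Φ ∘ splitPoints s m n := funext hΦ
  have hint := integrable_exp_mul_fourier G y
  rw [hΦ', (measurePreserving_splitPoints s m n).integrable_comp_emb
    (splitPoints s m n).measurableEmbedding] at hint
  refine ⟨hint, ?_⟩
  rw [eq_integral_fourier G y, hΦ', ← Measure.volume_eq_prod]
  exact (measurePreserving_splitPoints s m n).integral_comp' Φ

/-- If the Fourier transform of `G` is `h(w₁) · ĝ_{w₁}(w₂)`, where `w₁` are the first `m` and `w₂`
the last `n` momenta, then `G` is a superposition over `w₁` of the functions `g_{w₁}` of the last
`n` points, so it vanishes wherever all `g_{w₁}` with `h(w₁) ≠ 0` do. -/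
theorem exists_ne_zero_of_fourier_eq_first {s m n : ℕ} (G : Test s (m + n)) (h : NPoint s m → ℂ)
    (g : NPoint s m → Test s n)
    (hG : ∀ w, 𝓕 G w = h (firstPoints s m n w) * 𝓕 (g (firstPoints s m n w)) (lastPoints s m n w))
    (y : NPoint s (m + n)) (hy : G y ≠ 0) :
    ∃ w, h w ≠ 0 ∧ g w (lastPoints s m n y) ≠ 0 := by
  by_contra! hcon
  apply hy
  obtain ⟨hint, hGy⟩ := eq_integral_splitPoints G y (fun z =>
    Complex.exp (((2 * Real.pi * inner ℝ z.1 (firstPoints s m n y) : ℝ) : ℂ) * Complex.I) * h z.1 *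
    (Complex.exp (((2 * Real.pi * inner ℝ z.2 (lastPoints s m n y) : ℝ) : ℂ) * Complex.I) *
      𝓕 (g z.1) z.2)) fun w => by
    simp only [hG, inner_eq_first_add_last w y, mul_add, Complex.ofReal_add, add_mul,
      Complex.exp_add]
    ring
  rw [hGy, integral_prod _ hint]
  refine integral_eq_zero_of_ae (ae_of_all _ fun w => ?_)
  dsimp only
  rw [integral_const_mul, ← eq_integral_fourier]
  by_cases hw : h w = 0
  · simp [hw]
  · simp [hcon w hw]

/-- The analogue of `exists_ne_zero_of_fourier_eq_first` with the roles of the first and the last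
momenta exchanged. -/
theorem exists_ne_zero_of_fourier_eq_last {s m n : ℕ} (G : Test s (m + n)) (h : NPoint s n → ℂ)
    (g : NPoint s n → Test s m)
    (hG : ∀ w, 𝓕 G w = h (lastPoints s m n w) * 𝓕 (g (lastPoints s m n w)) (firstPoints s m n w))
    (y : NPoint s (m + n)) (hy : G y ≠ 0) :
    ∃ w, h w ≠ 0 ∧ g w (firstPoints s m n y) ≠ 0 := by
  by_contra! hcon
  apply hy
  obtain ⟨hint, hGy⟩ := eq_integral_splitPoints G y (fun z =>
    Complex.exp (((2 * Real.pi * inner ℝ z.2 (lastPoints s m n y) : ℝ) : ℂ) * Complex.I) * h z.2 *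
    (Complex.exp (((2 * Real.pi * inner ℝ z.1 (firstPoints s m n y) : ℝ) : ℂ) * Complex.I) *
      𝓕 (g z.2) z.1)) fun w => by
    simp only [hG, inner_eq_first_add_last w y, mul_add, Complex.ofReal_add, add_mul,
      Complex.exp_add]
    ring
  rw [hGy, integral_prod_symm _ hint]
  refine integral_eq_zero_of_ae (ae_of_all _ fun w => ?_)
  dsimp only
  rw [integral_const_mul, ← eq_integral_fourier]
  by_cases hw : h w = 0
  · simp [hw]
  · simp [hcon w hw]

theorem fourier_ne_zero_of_mem {s m : ℕ} {A : Set (Spacetime s)} {h : Test s m}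
    (hh : h ∈ momentumLocalTest m A) {w : NPoint s m} (hw : 𝓕 h w ≠ 0) (k : Fin m) :
    (fourierScale s m).symm w k ∈ A := by
  refine hh (subset_tsupport _ ?_) k
  change fourierConst s m * 𝓕 h (fourierScale s m ((fourierScale s m).symm w)) ≠ 0
  rw [ContinuousLinearEquiv.apply_symm_apply]
  exact mul_ne_zero (fourierConst_ne_zero s m) hw

/-- For fixed momenta `p` of `h`, in the backward cone, the factors
`R(p_l · Q p_r) = R(-Qp_l · p_r)` act on `f` as shifts by the vectors `-Qp_l = Q(-p_l) ∈ K`. -/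
theorem KeepsLocal.tsupport_deformedTensor_last {s m n : ℕ} {O : Set (Spacetime s)}
    {K : PointedCone ℝ (Spacetime s)} (hO : KeepsLocal O K) (R : DeformationFunction)
    {Q : Matrix (Fin (s + 2)) (Fin (s + 2)) ℝ}
    (hanti : ∀ p q : Spacetime s, mdot p (act Q q) = -mdot (act Q p) q)
    (hQ : ∀ p ∈ forwardCone s, act Q p ∈ K) {h : Test s m} {f : Test s n}
    (hh : h ∈ momentumLocalTest m (-forwardCone s)) (hf : f ∈ localTest n O) :
    tsupport (deformedTensor R Q h f) ⊆ {x | ∀ k : Fin n, x (Fin.natAdd m k) ∈ O} := by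
  obtain ⟨S', hS', hSO, hS⟩ := hO n (tsupport f) (isClosed_tsupport f) hf
  have hsub : tsupport (deformedTensor R Q h f) ⊆ lastPoints s m n ⁻¹' S' := by
    refine closure_minimal (fun y hy => ?_) (hS'.preimage (lastPoints s m n).continuous)
    let X : NPoint s m → Fin m × Fin n → Spacetime s := fun w i =>
      act Q (-(fourierScale s m).symm w i.1)
    obtain ⟨w, hw, hgw⟩ := exists_ne_zero_of_fourier_eq_first (deformedTensor R Q h f)
      (fun w => 𝓕 h w)
      (fun w => multiplier (fun p => ∏ i ∈ Finset.univ, R (mdot (X w i) (p i.2))) f) (fun w => by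
        rw [fourier_deformedTensor, fourier_multiplier (prod_mdot_temperate R _ _ _),
          ← Finset.univ_product_univ, Finset.prod_product]
        have : ∀ p q : Spacetime s, mdot p (act Q q) = mdot (act Q (-p)) q := by
          intro p q
          rw [hanti, act_neg]
          simp [mdot]
          ring
        simp only [X, this]
        ring) y hy
    obtain ⟨z, hz, hyz⟩ := multiplier_prod_support_cone K R _ _ _
      (fun i _ => hQ _ (fourier_ne_zero_of_mem hh hw i.1)) f _ hgw
    exact hS _ z hz (subset_tsupport _ hyz)
  exact fun x hx k => hSO _ (hsub hx) k

/-- For fixed momenta `p` of `h`, in the forward cone, the factors `R(p_l · Q p_r)` act on `f` as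
shifts by the vectors `Q p_r ∈ K`. -/
theorem KeepsLocal.tsupport_deformedTensor_first {s m n : ℕ} {O : Set (Spacetime s)}
    {K : PointedCone ℝ (Spacetime s)} (hO : KeepsLocal O K) (R : DeformationFunction)
    {Q : Matrix (Fin (s + 2)) (Fin (s + 2)) ℝ}
    (hQ : ∀ p ∈ forwardCone s, act Q p ∈ K) {f : Test s n} {h : Test s m}
    (hf : f ∈ localTest n O) (hh : h ∈ momentumLocalTest m (forwardCone s)) :
    tsupport (deformedTensor R Q f h) ⊆ {x | ∀ k : Fin n, x (Fin.castAdd m k) ∈ O} := by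
  obtain ⟨S', hS', hSO, hS⟩ := hO n (tsupport f) (isClosed_tsupport f) hf
  have hsub : tsupport (deformedTensor R Q f h) ⊆ firstPoints s n m ⁻¹' S' := by
    refine closure_minimal (fun y hy => ?_) (hS'.preimage (firstPoints s n m).continuous)
    let X : NPoint s m → Fin n × Fin m → Spacetime s := fun w i =>
      act Q ((fourierScale s m).symm w i.2)
    obtain ⟨w, hw, hgw⟩ := exists_ne_zero_of_fourier_eq_last (deformedTensor R Q f h)
      (fun w => 𝓕 h w)
      (fun w => multiplier (fun p => ∏ i ∈ Finset.univ, R (mdot (X w i) (p i.1))) f) (fun w => by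
        rw [fourier_deformedTensor, fourier_multiplier (prod_mdot_temperate R _ _ _),
          ← Finset.univ_product_univ, Finset.prod_product]
        simp only [X, mdot_comm _ (act Q _)]
        ring) y hy
    obtain ⟨z, hz, hyz⟩ := multiplier_prod_support_cone K R _ _ _
      (fun i _ => hQ _ (fourier_ne_zero_of_mem hh hw i.2)) f _ hgw
    exact hS _ z hz (subset_tsupport _ hyz)
  exact fun x hx k => hSO _ (hsub hx) k

/-! ### The opposite deformation -/

theorem alphaJ_of {s n : ℕ} (f : Test s n) : alphaJ s (of s n f) = of s n (jTest s n f) :=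
  DFinsupp.mapRange_single (hf := fun n => map_zero (jTest s n))

theorem jTest_tensor {s m n : ℕ} (f : Test s m) (g : Test s n) :
    jTest s (m + n) (tensor f g) = tensor (jTest s m f) (jTest s n g) := by
  ext x
  exact map_mul (starRingEnd ℂ) _ _

/-- The product deformed with `ρ'` is the `α_j`-conjugate of the product deformed with `ρ`. -/
theorem deformedMul_opposite_of_of {s m n : ℕ} (R : DeformationFunction)
    (Q : Matrix (Fin (s + 2)) (Fin (s + 2)) ℝ) (f : Test s m) (g : Test s n) :
    deformedMul (opposite (rho R Q).toEquiv) (of s m f) (of s n g) =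
      of s (m + n) (jTest s (m + n) (deformedTensor R Q (jTest s m f) (jTest s n g))) := by
  have h : ∀ (k : ℕ) (F : Test s k), opposite (rho R Q).toEquiv (of s k F) =
      of s k (jTest s k (multiplier (rhoN R Q k) (jTest s k F))) := by
    intro k F
    change alphaJ s ((rho R Q).toEquiv (alphaJ s (of s k F))) = _
    rw [alphaJ_of, rho_of, alphaJ_of]
  have h' : ∀ (k : ℕ) (F : Test s k), (opposite (rho R Q).toEquiv).symm (of s k F) =
      of s k (jTest s k (multiplier (rhoN R (-Q) k) (jTest s k F))) := by
    intro k F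
    change alphaJ s ((rho R Q).toEquiv.symm (alphaJ s (of s k F))) = _
    rw [alphaJ_of, rho_symm_of, alphaJ_of]
  rw [deformedMul, h, h, of_mul_of, h', jTest_tensor, jTest_jTest, jTest_jTest, deformedTensor]

theorem tsupport_jTest_subset {s n : ℕ} (f : Test s n) :
    tsupport (jTest s n f) ⊆
      {x | (WithLp.toLp 2 fun k => jFlip s (x k) : NPoint s n) ∈ tsupport f} := by
  have hc : Continuous fun x : NPoint s n => (WithLp.toLp 2 fun k => jFlip s (x k) : NPoint s n) :=
    (LinearIsometryEquiv.piLpCongrRight 2 (fun _ : Fin n => jFlip s)).continuous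
  refine closure_minimal (fun x hx => subset_tsupport _ fun h0 => hx ?_)
    ((isClosed_tsupport f).preimage hc)
  rw [jTest_apply, h0, map_zero]

theorem jFlip_jFlip {s : ℕ} (x : Spacetime s) : jFlip s (jFlip s x) = x := by
  ext i
  by_cases hi : i = 0 ∨ i = 1 <;> simp [jFlip, hi]

theorem jTest_mem_localTest {s n : ℕ} {O : Set (Spacetime s)} {f : Test s n}
    (hf : f ∈ localTest n O) : jTest s n f ∈ localTest n {y | jFlip s y ∈ O} :=
  fun _ hx k => hf (tsupport_jTest_subset f hx) k

theorem jFlip_zero_coord {s : ℕ} (x : Spacetime s) : jFlip s x 0 = -x 0 := by simp [jFlip]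

theorem jFlip_one_coord {s : ℕ} (x : Spacetime s) : jFlip s x 1 = -x 1 := by simp [jFlip]

/-- `-j` preserves the forward cone. It is the action of `α_j` on momenta, since `α_j`
conjugates. -/
theorem jFlip_neg_mem_forwardCone {s : ℕ} {x : Spacetime s} :
    -jFlip s x ∈ forwardCone s ↔ x ∈ forwardCone s := by
  have h1 : mdot (-jFlip s x) (-jFlip s x) = mdot x x := by
    rw [mdot_self, mdot_self, norm_neg, LinearIsometryEquiv.norm_map, PiLp.neg_apply,
      jFlip_zero_coord, neg_neg]
  change 0 ≤ mdot (-jFlip s x) (-jFlip s x) ∧ 0 ≤ -jFlip s x 0 ↔ _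
  rw [h1, jFlip_zero_coord, neg_neg]
  rfl

theorem momentum_jTest_ne_zero {s n : ℕ} {f : Test s n} {p : NPoint s n}
    (hp : momentum s n (jTest s n f) p ≠ 0) :
    momentum s n f (-WithLp.toLp 2 fun k => jFlip s (p k)) ≠ 0 := by
  have h : ∀ (g : Test s n) q, momentum s n g q = fourierConst s n * 𝓕 g (fourierScale s n q) :=
    fun g q => rfl
  rw [h, fourier_jTest] at hp
  rw [h]
  have h2 : fourierScale s n (-WithLp.toLp 2 fun k => jFlip s (p k)) =
      -WithLp.toLp 2 fun k => jFlip s (fourierScale s n p k) := by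
    rw [map_neg]
    congr 1
    refine PiLp.ext fun k => ?_
    change (-(2 * Real.pi)⁻¹ : ℝ) • spaceFlip s (jFlip s (p k)) =
      jFlip s ((-(2 * Real.pi)⁻¹ : ℝ) • spaceFlip s (p k))
    rw [map_smul]
    congr 1
    ext i
    by_cases h0 : i = 0 <;> by_cases h1 : i = 1 <;> simp [spaceFlip, jFlip, h0, h1]
  rw [h2]
  refine mul_ne_zero (fourierConst_ne_zero s n) fun h0 => hp ?_
  rw [h0, map_zero, mul_zero]

theorem jTest_mem_momentumLocalTest {s n : ℕ} {A : Set (Spacetime s)} {f : Test s n}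
    (hf : f ∈ momentumLocalTest n A) (hA : ∀ p, -jFlip s p ∈ A → p ∈ A) :
    jTest s n f ∈ momentumLocalTest n A := by
  intro x hx k
  have hc : Continuous fun x : NPoint s n =>
      (-WithLp.toLp 2 fun k => jFlip s (x k) : NPoint s n) :=
    (LinearIsometryEquiv.piLpCongrRight 2 (fun _ : Fin n => jFlip s)).continuous.neg
  have hsub : tsupport (momentum s n (jTest s n f)) ⊆
      {x | (-WithLp.toLp 2 fun k => jFlip s (x k) : NPoint s n) ∈ tsupport (momentum s n f)} :=
    closure_minimal (fun x hx => subset_tsupport _ (momentum_jTest_ne_zero hx))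
      ((isClosed_tsupport _).preimage hc)
  exact hA _ (hf (hsub hx) k)

/-- The support statements for `ρ'` and `O'` are those for `ρ` and `j O'`. -/
theorem productsKeepSupport_of_keepsLocal {s : ℕ} (R : DeformationFunction)
    {Q : Matrix (Fin (s + 2)) (Fin (s + 2)) ℝ}
    (hanti : ∀ p q : Spacetime s, mdot p (act Q q) = -mdot (act Q p) q)
    {K : PointedCone ℝ (Spacetime s)} (hQ : ∀ p ∈ forwardCone s, act Q p ∈ K)
    {O O' : Set (Spacetime s)} (hO : KeepsLocal O K) (hO' : KeepsLocal {y | jFlip s y ∈ O'} K) :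
    ProductsKeepSupport R Q O O' := by
  intro n m hm hp f g' hhm hhp hf hg
  have hj : ∀ {y : Spacetime s}, jFlip s y ∈ {y | jFlip s y ∈ O'} → y ∈ O' := by
    intro y hy
    have h : jFlip s (jFlip s y) ∈ O' := hy
    rwa [jFlip_jFlip] at h
  refine ⟨⟨_, deformedMul_of_of R Q hm f, hO.tsupport_deformedTensor_last R hanti hQ hhm hf⟩,
    ⟨_, deformedMul_opposite_of_of R Q hm g', fun x hx k => hj ?_⟩,
    ⟨_, deformedMul_opposite_of_of R Q g' hp, fun x hx k => hj ?_⟩,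
    ⟨_, deformedMul_of_of R Q f hp, hO.tsupport_deformedTensor_first R hQ hf hhp⟩⟩
  · refine hO'.tsupport_deformedTensor_last R hanti hQ
      (jTest_mem_momentumLocalTest hhm fun p h => ?_) (jTest_mem_localTest hg)
      (tsupport_jTest_subset _ hx) k
    rw [Set.mem_neg] at h ⊢
    rw [← jFlip_neg_mem_forwardCone, map_neg]
    exact h
  · exact hO'.tsupport_deformedTensor_first R hQ (jTest_mem_localTest hg)
      (jTest_mem_momentumLocalTest hhp fun p h => jFlip_neg_mem_forwardCone.1 h)
      (tsupport_jTest_subset _ hx) k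

theorem jFlip_mem_neg_rightWedge (s : ℕ) : {y | jFlip s y ∈ -rightWedge s} = rightWedge s := by
  ext y
  change |(-jFlip s y) 0| < (-jFlip s y) 1 ↔ |y 0| < y 1
  rw [PiLp.neg_apply, PiLp.neg_apply, jFlip_zero_coord, jFlip_one_coord, neg_neg, neg_neg]

theorem jFlip_sub_mem_closure {s : ℕ} (b : Spacetime s) :
    {y | jFlip s y ∈ {y | y - b ∈ closure (-rightWedge s)}} =
      {y | y - jFlip s b ∈ closure (rightWedge s)} := by
  ext y
  change jFlip s y - b ∈ closure (-rightWedge s) ↔ y - jFlip s b ∈ closure (rightWedge s)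
  rw [mem_closure_neg_rightWedge, ← mem_wedgeCone_iff, mem_wedgeCone, mem_wedgeCone]
  simp only [PiLp.sub_apply, jFlip_zero_coord, jFlip_one_coord, neg_sub]
  rw [sub_neg_eq_add, sub_neg_eq_add, sub_neg_eq_add, sub_neg_eq_add, add_comm (b 0),
    add_comm (b 1)]

end BorchersUhlmann

end

open BorchersUhlmann in
theorem mainTheorem6 (s : ℕ) (hs : Even s) (R : DeformationFunction) :
    -- each `τ^R_x` is a continuous `*`-automorphism with continuous inverse
    (∀ x : Spacetime s, ∃ T : BU s ≃⋆ₐ[ℂ] BU s,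
      (∀ f, T f = shift R x f) ∧ T 1 = 1 ∧ Continuous T ∧ Continuous T.symm) ∧
    -- the open wedges `±W₀`, for `x` in the closure of `W₀` which is zero or off the edge
    (∀ x ∈ closure (rightWedge s), (x ∈ edge s → x = 0) →
      (∀ f ∈ localAlgebra (rightWedge s), shift R x f ∈ localAlgebra (rightWedge s)) ∧
      (∀ f ∈ localAlgebra (-rightWedge s), shift R (-x) f ∈ localAlgebra (-rightWedge s)) ∧
      (∀ (f : BU s) (n : ℕ),
        (f n ∈ localTest n (rightWedge s) →
          shift R x f n ∈ localTest n (rightWedge s)) ∧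
        (f n ∈ localTest n (-rightWedge s) →
          shift R (-x) f n ∈ localTest n (-rightWedge s)))) ∧
    -- the closed wedges `closure (±W₀) + a`, for all `x` in the closure of `W₀`
    (∀ x ∈ closure (rightWedge s), ∀ a : Spacetime s,
      (∀ f ∈ localAlgebra {y | y - a ∈ closure (rightWedge s)},
        shift R x f ∈ localAlgebra {y | y - a ∈ closure (rightWedge s)}) ∧
      (∀ f ∈ localAlgebra {y | y - a ∈ closure (-rightWedge s)},
        shift R (-x) f ∈ localAlgebra {y | y - a ∈ closure (-rightWedge s)})) ∧
    -- deformed products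
    (∀ Q : Matrix (Fin (s + 2)) (Fin (s + 2)) ℝ, IsAdmissible Q →
      ((∀ p ∈ forwardCone s, act Q p ∈ edge s → act Q p = 0) →
        ProductsKeepSupport R Q (rightWedge s) (-rightWedge s)) ∧
      (∀ a b : Spacetime s,
        ProductsKeepSupport R Q {y | y - a ∈ closure (rightWedge s)}
          {y | y - b ∈ closure (-rightWedge s)})) := by
  refine ⟨fun x => ⟨shiftEquiv R x, fun _ => rfl, shift_one R x, continuous_shift R x,
    continuous_shift R (-x)⟩, fun x hx hxE => ?_, fun x hx a => ?_, fun Q hQ => ⟨fun hE => ?_,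
    fun a b => ?_⟩⟩
  · obtain ⟨C, hC, hxC⟩ := exists_mem_narrowCone hx hxE
    have hp := keepsLocal_rightWedge s hC
    have hn := keepsLocal_neg_rightWedge s hC
    have hxC' : -x ∈ -narrowCone s C := by simpa using hxC
    exact ⟨fun f hf => hp.shift_mem_localAlgebra R hxC hf,
      fun f hf => hn.shift_mem_localAlgebra R hxC' hf,
      fun f n => ⟨fun hf => hp.shift_mem_localTest R hxC hf,
        fun hf => hn.shift_mem_localTest R hxC' hf⟩⟩
  · have hx' := mem_wedgeCone_iff.2 hx
    exact ⟨fun f hf => (keepsLocal_translate_closure a).shift_mem_localAlgebra R hx' hf,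
      fun f hf => (keepsLocal_translate_closure_neg a).shift_mem_localAlgebra R
        (by simpa using hx') hf⟩
  · obtain ⟨C, hC, hQC⟩ := hQ.exists_narrowCone hE
    refine productsKeepSupport_of_keepsLocal R hQ.antisymm hQC (keepsLocal_rightWedge s hC) ?_
    rw [jFlip_mem_neg_rightWedge]
    exact keepsLocal_rightWedge s hC
  · refine productsKeepSupport_of_keepsLocal R hQ.antisymm
      (fun p hp => mem_wedgeCone_iff.2 (hQ.map_cone p hp)) (keepsLocal_translate_closure a) ?_
    rw [jFlip_sub_mem_closure]
    exact keepsLocal_translate_closure _
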